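/- Let $m\ge 1$ and let $H^m=\mathbb{R}^{2m+1}$ be the Heisenberg group, with points $q=(x_1,\dots,x_m,y_1,\dots,y_m,t)$, group law $(z,t)\circ(z',t')=\bigl(z+z',\,t+t'+2\sum_{i=1}^m(y_ix_i'-x_iy_i')\bigr)$ for $z=(x,y)$, $z'=(x',y')$, and left-invariant vector fields $$X_j=\frac{\partial}{\partial x_j}+2y_j\frac{\partial}{\partial t},\qquad Y_j=\frac{\partial}{\partial y_j}-2x_j\frac{\partial}{\partial t},\qquad j=1,\dots,m.$$ For a $C^1$ function $u$ write $\nabla_{H^m}u=(X_1u,\dots,X_mu,Y_1u,\dots,Y_mu)$, with the Euclidean product $\cdot$ and norm $|\cdot|_{H^m}$ on $\mathbb{R}^{2m}$. Let $\varphi:[0,\infty)\to\mathbb{R}$ satisfy * $\varphi\in C^0([0,\infty))\cap C^1((0,\infty))$, $\varphi(0)=0$, and $\varphi'>0$ on $(0,\infty)$; * there are constants $D>0$ and $\tau\ge 0$ such that $s\,\varphi'(st)\le D\,s^{\tau}\varphi'(t)$ for all $s\in(0,1]$ and $t>0$. Let $\Omega\subset H^m$ be a domain (a non-empty connected open set,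 not necessarily bounded), and let $u\in C^0(\overline\Omega)\cap C^1(\Omega)$ satisfy $\Delta^\varphi_{H^m}u\ge 0$ in $\Omega$ in the weak sense, that is, $$-\int_\Omega |\nabla_{H^m}u|_{H^m}^{-1}\,\varphi\bigl(|\nabla_{H^m}u|_{H^m}\bigr)\,\nabla_{H^m}u\cdot\nabla_{H^m}\zeta\ \ge\ 0\qquad\text{for all }\zeta\in C_c^\infty(\Omega),\ \zeta\ge 0$$ (integration with respect to Lebesgue measure; the vector $|\nabla_{H^m}u|_{H^m}^{-1}\varphi(|\nabla_{H^m}u|_{H^m})\nabla_{H^m}u$ is taken to be $0$ where $\nabla_{H^m}u=0$). Let $u^*=\sup_\Omega u$. If $u(q_M)=u^*$ for some $q_M\in\Omega$, then $u\equiv u^*$ on $\overline\Omega$. -/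

import Mathlib

open scoped ContDiff

/-- The Heisenberg group `H^m`: the underlying manifold is `ℝ^(2m+1)`, with points
`q = (x, y, t)`.  (The product carries a sup norm, but only its topology, its smooth structure
and its Lebesgue measure `volume` are used.) -/
abbrev Heis (m : ℕ) : Type := (Fin m → ℝ) × (Fin m → ℝ) × ℝ

/-- The group law of the Heisenberg group. -/
def heisMul {m : ℕ} (q q' : Heis m) : Heis m :=
  (q.1 + q'.1, q.2.1 + q'.2.1,
    q.2.2 + q'.2.2 + 2 * ∑ i, (q.2.1 i * q'.1 i - q.1 i * q'.2.1 i))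

/-- The vector field `X_j = ∂/∂x_j + 2 y_j ∂/∂t`. -/
def heisX {m : ℕ} (j : Fin m) (q : Heis m) : Heis m := (Pi.single j 1, 0, 2 * q.2.1 j)

/-- The vector field `Y_j = ∂/∂y_j - 2 x_j ∂/∂t`. -/
def heisY {m : ℕ} (j : Fin m) (q : Heis m) : Heis m := (0, Pi.single j 1, -2 * q.1 j)

/-- `X_j` is the left-invariant vector field with value `∂/∂x_j` at the origin. -/
theorem heisMul_eq_add_heisX {m : ℕ} (j : Fin m) (q : Heis m) (s : ℝ) :
    heisMul q (s • (Pi.single j 1, 0, 0)) = q + s • heisX j q := by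
  refine Prod.ext ?_ (Prod.ext ?_ ?_) <;> simp [heisMul, heisX, Pi.single_apply]
  ring

/-- `Y_j` is the left-invariant vector field with value `∂/∂y_j` at the origin. -/
theorem heisMul_eq_add_heisY {m : ℕ} (j : Fin m) (q : Heis m) (s : ℝ) :
    heisMul q (s • (0, Pi.single j 1, 0)) = q + s • heisY j q := by
  refine Prod.ext ?_ (Prod.ext ?_ ?_) <;> simp [heisMul, heisY, Pi.single_apply]
  ring

/-- The Heisenberg gradient of `u` at `q`, as the vector of its components
`(X_1 u, …, X_m u, Y_1 u, …, Y_m u)` in the frame `X_1, …, X_m, Y_1, …, Y_m`, which is orthonormal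
for the product on the horizontal bundle. -/
noncomputable def heisGrad {m : ℕ} (u : Heis m → ℝ) (q : Heis m) :
    EuclideanSpace ℝ (Fin m ⊕ Fin m) :=
  WithLp.toLp 2
    (Sum.elim (fun j => fderiv ℝ u q (heisX j q)) (fun j => fderiv ℝ u q (heisY j q)))

/-- The flux `|∇_H u|⁻¹ φ(|∇_H u|) ∇_H u` of the `φ`-Laplacian; it is `0` where `∇_H u = 0`, which
is its continuous extension because `φ(0) = 0`. -/
noncomputable def heisFlux {m : ℕ} (φ : ℝ → ℝ) (u : Heis m → ℝ) (q : Heis m) :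
    EuclideanSpace ℝ (Fin m ⊕ Fin m) :=
  (‖heisGrad u q‖⁻¹ * φ ‖heisGrad u q‖) • heisGrad u q

/-- `Δ^φ_{H^m} u ≥ 0` in `Ω` in the weak sense, for `u` of class `C¹` on the open set `Ω`:
`-∫_Ω |∇_H u|⁻¹ φ(|∇_H u|) ∇_H u · ∇_H ζ ≥ 0` for all `0 ≤ ζ ∈ C_c^∞(Ω)`. -/
def PhiLaplacianNonneg {m : ℕ} (φ : ℝ → ℝ) (Ω : Set (Heis m)) (u : Heis m → ℝ) : Prop :=
  ∀ ζ : Heis m → ℝ, ContDiff ℝ ∞ ζ → HasCompactSupport ζ → tsupport ζ ⊆ Ω → (∀ q, 0 ≤ ζ q) →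
    0 ≤ -∫ q in Ω, inner ℝ (heisFlux φ u q) (heisGrad ζ q)

/-- The structural conditions on `φ`, regarded as a function on `[0, ∞)`. -/
structure PhiStructural (φ : ℝ → ℝ) : Prop where
  continuousOn : ContinuousOn φ (Set.Ici 0)
  contDiffOn : ContDiffOn ℝ 1 φ (Set.Ioi 0)
  map_zero : φ 0 = 0
  deriv_pos : ∀ t : ℝ, 0 < t → 0 < deriv φ t

/-- The relaxed homogeneity condition on `φ'`: `s φ'(s t) ≤ D s^τ φ'(t)` for some constants `D > 0`
and `τ ≥ 0`, for all `s ∈ (0, 1]` and `t > 0`. -/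
def PhiRelaxedHomogeneous (φ : ℝ → ℝ) : Prop :=
  ∃ D τ : ℝ, 0 < D ∧ 0 ≤ τ ∧
    ∀ s t : ℝ, 0 < s → s ≤ 1 → 0 < t → s * deriv φ (s * t) ≤ D * s ^ τ * deriv φ t

/-! The argument is Hopf's, combined with Bony's propagation of maxima. Let F be the set where u
attains its maximum.

Boundary point lemma (`PhiLaplacianNonneg.heisGrad_eq_zero_of_touching`): if a smooth w restricted
to F has a local maximum at q₀ ∈ F, then the horizontal gradient of w vanishes at q₀. Otherwise one
builds, near q₀, a strict subsolution h = η ∘ w₁ with h(q₀) = 0 and nonzero gradient there, where w₁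
is w normalised and bent so that F meets {w₁ ≥ 0} only at q₀. Comparison gives u ≤ u* - h, so u and
u + h both have a local maximum at q₀, which forces dh = 0.

The flux may degenerate, so the slope θ = η' has to solve θ' = M(θ + φ(θ)/φ'(θ)) while staying
positive and arbitrarily small. This is possible because in the variable log θ the travel time to -∞
is infinite, an Osgood condition that follows from tφ'(t) being increasing up to a constant factor.

Propagation (`add_heisHor_mem_of_touching`): a relatively closed set with no nonzero horizontal
normals is invariant under the horizontal flows. Commutators of X_j and Y_j produce the t-direction,
so horizontal paths fill neighbourhoods (`mem_nhds_of_horizontal_invariant`). Hence F is open and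
relatively closed, and connectedness concludes. -/

open Filter Topology Set MeasureTheory

/-! ### An Osgood condition and inversion of the travel time -/

/-- If the integral converged, the integrand would tend to 0, so eventually p ≤ f and (log f)' = p/f
is at most twice the integrand. Then log f would be bounded below at -∞, against f → 0. It is
applied to f(x) = φ(eˣ). -/
theorem tendsto_integral_div_add_atBot {f p : ℝ → ℝ} {D : ℝ} (hf : ∀ x, HasDerivAt f (p x) x)
    (hf0 : ∀ x, 0 < f x) (hp0 : ∀ x, 0 < p x) (hpc : Continuous p)
    (hD : ∀ y x, y ≤ x → p y ≤ D * p x) (hlim : Tendsto f atBot (𝓝 0)) :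
    Tendsto (fun x => ∫ s in (0 : ℝ)..x, p s / (p s + f s)) atBot atBot := by
  have hfc : Continuous f := continuous_iff_continuousAt.2 fun x => (hf x).continuousAt
  have hD0 : 0 < D := by
    have := hD 0 0 le_rfl
    nlinarith [hp0 0]
  set κ : ℝ → ℝ := fun s => p s / (p s + f s) with hκ
  have hden : ∀ s, 0 < p s + f s := fun s => add_pos (hp0 s) (hf0 s)
  have hκ0 : ∀ s, 0 < κ s := fun s => div_pos (hp0 s) (hden s)
  have hκc : Continuous κ := hpc.div (hpc.add hfc) fun s => (hden s).ne'
  set Ψ : ℝ → ℝ := fun x => ∫ s in (0 : ℝ)..x, κ s with hΨ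
  have hΨd : ∀ x, HasDerivAt Ψ (κ x) x := fun x =>
    intervalIntegral.integral_hasDerivAt_right (hκc.intervalIntegrable _ _)
      (hκc.stronglyMeasurableAtFilter _ _) hκc.continuousAt
  have hmono : StrictMono Ψ := strictMono_of_hasDerivAt_pos hΨd hκ0
  rcases tendsto_atBot_of_monotone hmono.monotone with h | ⟨l, hl⟩
  · exact h
  exfalso
  have hlow : ∀ x, l ≤ Ψ x := fun x => hmono.monotone.le_of_tendsto hl x
  have hfmono : Monotone f := monotone_of_deriv_nonneg (fun x => (hf x).differentiableAt)
    fun x => by rw [(hf x).deriv]; exact (hp0 x).le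
  -- a one-sided Harnack inequality for the integrand
  have harnack : ∀ y x, y ≤ x → x ≤ y + 1 → κ y / (1 + D) ≤ κ x := by
    intro y x hyx hxy
    have h1 := hD y x hyx
    have h2 : f x ≤ f y + D * p x := by
      have : f x - f y ≤ D * p x * (x - y) := by
        refine Convex.image_sub_le_mul_sub_of_deriv_le (convex_Iic x) hfc.continuousOn
          (fun z _ => (hf z).differentiableAt.differentiableWithinAt) ?_ y hyx x self_mem_Iic hyx
        intro z hz
        rw [interior_Iic] at hz
        rw [(hf z).deriv]
        exact hD z x (le_of_lt hz)
      have h3 : D * p x * (x - y) ≤ D * p x * 1 :=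
        mul_le_mul_of_nonneg_left (by linarith) (mul_pos hD0 (hp0 x)).le
      linarith
    simp only [hκ]
    rw [div_div, div_le_div_iff₀ (by have := hden y; positivity) (hden x)]
    have a1 : p y * f x ≤ p y * (f y + D * p x) := mul_le_mul_of_nonneg_left h2 (hp0 y).le
    have a2 : p y * f y ≤ D * p x * f y := mul_le_mul_of_nonneg_right h1 (hf0 y).le
    have := mul_pos (hp0 x) (hf0 y)
    nlinarith
  -- Convergence makes the integrals over [x, x + 1] small; the Harnack inequality turns this into
  -- pointwise smallness.
  have hsmall : ∀ᶠ x in atBot, κ x ≤ 1 / 2 := by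
    have h1 : Tendsto (fun x => Ψ (x + 1) - Ψ x) atBot (𝓝 0) := by
      simpa using (hl.comp (tendsto_atBot_add_const_right _ 1 tendsto_id)).sub hl
    have h2 : ∀ᶠ x in atBot, Ψ (x + 1) - Ψ x < 1 / (2 * (1 + D)) :=
      h1.eventually_lt_const (by positivity)
    filter_upwards [h2] with x hx
    have h3 : κ x / (1 + D) * (x + 1 - x) ≤ Ψ (x + 1) - Ψ x := by
      refine Convex.mul_sub_le_image_sub_of_le_deriv (convex_Icc x (x + 1))
        (fun z _ => (hΨd z).continuousAt.continuousWithinAt)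
        (fun z _ => (hΨd z).differentiableAt.differentiableWithinAt) ?_ x
        (by simp) (x + 1) (by simp) (by simp)
      intro z hz
      rw [interior_Icc] at hz
      rw [(hΨd z).deriv]
      exact harnack x z hz.1.le hz.2.le
    have h4 : κ x / (1 + D) < 1 / (2 * (1 + D)) := by linarith
    rw [div_lt_div_iff₀ (by positivity) (by positivity)] at h4
    nlinarith
  obtain ⟨x₀, hx₀⟩ := eventually_atBot.1 hsmall
  have hbound : ∀ x ≤ x₀, Real.log (f x₀) - 2 * (Ψ x₀ - l) ≤ Real.log (f x) := by
    intro x hx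
    have h1 : (fun z => Real.log (f z) - 2 * Ψ z) x₀ - (fun z => Real.log (f z) - 2 * Ψ z) x
        ≤ 0 * (x₀ - x) := by
      have hd : ∀ z, HasDerivAt (fun z => Real.log (f z) - 2 * Ψ z) (p z / f z - 2 * κ z) z :=
        fun z => ((hf z).log (hf0 z).ne').sub ((hΨd z).const_mul 2)
      refine Convex.image_sub_le_mul_sub_of_deriv_le (convex_Iic x₀)
        (fun z _ => (hd z).continuousAt.continuousWithinAt)
        (fun z _ => (hd z).differentiableAt.differentiableWithinAt) ?_ x hx x₀ self_mem_Iic hx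
      intro z hz
      rw [interior_Iic] at hz
      rw [(hd z).deriv]
      have h2 := hx₀ z (le_of_lt hz)
      simp only [hκ] at h2 ⊢
      rw [div_le_div_iff₀ (hden z) two_pos] at h2
      have h3 : p z / f z ≤ 2 * (p z / (p z + f z)) := by
        rw [← mul_div_assoc, div_le_div_iff₀ (hf0 z) (hden z)]
        nlinarith [hp0 z]
      linarith
    have := hlow x
    simp only at h1
    linarith
  have hlog : Tendsto (fun x => Real.log (f x)) atBot atBot :=
    Real.tendsto_log_nhdsGT_zero.comp
      (tendsto_nhdsWithin_iff.2 ⟨hlim, Eventually.of_forall hf0⟩)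
  obtain ⟨x, hx1, hx2⟩ := ((hlog.eventually (eventually_lt_atBot
    (Real.log (f x₀) - 2 * (Ψ x₀ - l)))).and (eventually_le_atBot x₀)).exists
  exact absurd (hbound x hx2) (not_le.2 hx1)

theorem exists_hasDerivAt_inverse_of_pos {g : ℝ → ℝ} (hg0 : ∀ x, 0 < g x)
    {Ψ : ℝ → ℝ} (hΨ : ∀ x, HasDerivAt Ψ (g x) x) (htop : Tendsto Ψ atTop atTop)
    (hbot : Tendsto Ψ atBot atBot) :
    ∃ X : ℝ → ℝ, (∀ y, Ψ (X y) = y) ∧ StrictMono X ∧ Continuous X ∧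
      ∀ y, HasDerivAt X (g (X y))⁻¹ y := by
  have hmono : StrictMono Ψ := strictMono_of_hasDerivAt_pos hΨ hg0
  have hcont : Continuous Ψ := continuous_iff_continuousAt.2 fun x => (hΨ x).continuousAt
  let e : ℝ ≃o ℝ := hmono.orderIsoOfSurjective Ψ (hcont.surjective htop hbot)
  have he : ∀ y, Ψ (e.symm y) = y := fun y => e.apply_symm_apply y
  refine ⟨e.symm, he, e.symm.strictMono, e.symm.continuous, fun y => ?_⟩
  exact (hΨ (e.symm y)).of_local_left_inverse e.symm.continuous.continuousAt (hg0 _).ne'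
    (Eventually.of_forall he)

/-- Take s = r/t and bound s^τ by 1. What the proof needs of the homogeneity condition is only this:
tφ'(t) is increasing up to a constant factor. -/
theorem PhiRelaxedHomogeneous.mul_deriv_le {φ : ℝ → ℝ} (hφ : PhiStructural φ)
    (hφ2 : PhiRelaxedHomogeneous φ) :
    ∃ D : ℝ, 1 ≤ D ∧ ∀ r t, 0 < r → r ≤ t → r * deriv φ r ≤ D * (t * deriv φ t) := by
  obtain ⟨D, τ, hD, hτ, h⟩ := hφ2
  have key : ∀ r t, 0 < r → r ≤ t → r * deriv φ r ≤ D * (t * deriv φ t) := by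
    intro r t hr hrt
    have ht : 0 < t := hr.trans_le hrt
    have h1 := h (r / t) t (by positivity) ((div_le_one ht).2 hrt) ht
    rw [div_mul_cancel₀ _ ht.ne'] at h1
    have h2 : (r / t) ^ τ ≤ 1 := Real.rpow_le_one (by positivity) ((div_le_one ht).2 hrt) hτ
    have h3 : D * (r / t) ^ τ * deriv φ t ≤ D * 1 * deriv φ t := by
      have := hφ.deriv_pos t ht
      gcongr
    have h4 : r / t * deriv φ r ≤ D * deriv φ t := by linarith
    calc r * deriv φ r = t * (r / t * deriv φ r) := by field_simp
      _ ≤ t * (D * deriv φ t) := by gcongr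
      _ = _ := by ring
  refine ⟨D, ?_, key⟩
  have := key 1 1 one_pos le_rfl
  nlinarith [hφ.deriv_pos 1 one_pos]

/-! ### Consequences of the structural conditions; slope profiles -/

section Structural
variable {φ : ℝ → ℝ}

theorem PhiStructural.hasDerivAt (hφ : PhiStructural φ) {t : ℝ} (ht : 0 < t) :
    HasDerivAt φ (deriv φ t) t :=
  ((hφ.contDiffOn.contDiffAt (Ioi_mem_nhds ht)).differentiableAt one_ne_zero).hasDerivAt

theorem PhiStructural.continuousOn_deriv (hφ : PhiStructural φ) :
    ContinuousOn (deriv φ) (Ioi 0) :=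
  hφ.contDiffOn.continuousOn_deriv_of_isOpen isOpen_Ioi le_rfl

theorem PhiStructural.strictMonoOn (hφ : PhiStructural φ) : StrictMonoOn φ (Ici 0) := by
  refine strictMonoOn_of_deriv_pos (convex_Ici 0) hφ.continuousOn fun x hx => ?_
  rw [interior_Ici] at hx
  exact hφ.deriv_pos x hx

theorem PhiStructural.pos (hφ : PhiStructural φ) {t : ℝ} (ht : 0 < t) : 0 < φ t := by
  have := hφ.strictMonoOn self_mem_Ici ht.le ht
  rwa [hφ.map_zero] at this

/-- On [s, t] ⊆ [s, 3s] one has φ' ≤ 3Dφ'(t), and the mean value theorem applies. With s = θ and t =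
θ|∇w|, this measures the flux by φ'(t) and the right-hand side of the profile equation at θ. -/
theorem PhiStructural.le_deriv_mul (hφ : PhiStructural φ) {D : ℝ} (hD0 : 1 ≤ D)
    (hD : ∀ r t, 0 < r → r ≤ t → r * deriv φ r ≤ D * (t * deriv φ t)) {s t : ℝ} (hs : 0 < s)
    (hst : s ≤ t) (hts : t ≤ 3 * s) :
    φ t ≤ deriv φ t * (D * (6 * s + 3 * (φ s / deriv φ s))) := by
  have ht : 0 < t := hs.trans_le hst
  have hder : ∀ r, s ≤ r → r ≤ t → deriv φ r ≤ 3 * D * deriv φ t := by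
    intro r hr hrt
    have hr0 : 0 < r := hs.trans_le hr
    have h1 := hD r t hr0 hrt
    have h2 : D * (t * deriv φ t) ≤ D * (3 * r * deriv φ t) := by
      have := hφ.deriv_pos t ht
      gcongr
      linarith
    have h3 : r * deriv φ r ≤ r * (3 * D * deriv φ t) := by linarith
    exact le_of_mul_le_mul_left h3 hr0
  have h1 : φ t - φ s ≤ 3 * D * deriv φ t * (t - s) := by
    refine Convex.image_sub_le_mul_sub_of_deriv_le (convex_Icc s t)
      (fun z hz => (hφ.hasDerivAt (hs.trans_le hz.1)).continuousAt.continuousWithinAt)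
      (fun z hz => ?_) ?_ s (left_mem_Icc.2 hst) t (right_mem_Icc.2 hst) hst
    · rw [interior_Icc] at hz
      exact (hφ.hasDerivAt (hs.trans hz.1)).differentiableAt.differentiableWithinAt
    · intro z hz
      rw [interior_Icc] at hz
      exact hder z hz.1.le hz.2.le
  have h2 := hφ.deriv_pos t ht
  have h3 : 3 * D * deriv φ t * (t - s) ≤ 3 * D * deriv φ t * (2 * s) := by
    gcongr
    linarith
  have h4 : φ s ≤ 3 * D * deriv φ t * (φ s / deriv φ s) := by
    have h5 := hφ.deriv_pos s hs
    calc φ s = deriv φ s * (φ s / deriv φ s) := by field_simp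
      _ ≤ _ := by
        have := (hφ.pos hs).le
        gcongr
        exact hder s le_rfl hst
  linarith

/-- Slope profiles of barriers. -/
theorem PhiStructural.exists_profile (hφ : PhiStructural φ) {D : ℝ}
    (hD : ∀ r t, 0 < r → r ≤ t → r * deriv φ r ≤ D * (t * deriv φ t))
    {M δ : ℝ} (hM : 0 < M) (hδ : 0 < δ) (b : ℝ) :
    ∃ θ : ℝ → ℝ, ContDiff ℝ 1 θ ∧ (∀ y, 0 < θ y) ∧ (∀ y ≤ b, θ y ≤ δ) ∧
      ∀ y ≤ b, deriv θ y = M * (θ y + φ (θ y) / deriv φ (θ y)) := by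
  -- Writing θ = exp X turns the equation into X' = M/κ(X) with κ = p/(p + f), that is, Ψ(X(y)) = My
  -- - c for a primitive Ψ of κ. Divergence of Ψ at -∞ keeps θ from reaching 0 in finite time.
  set f : ℝ → ℝ := fun x => φ (Real.exp x) with hf_def
  set p : ℝ → ℝ := fun x => Real.exp x * deriv φ (Real.exp x) with hp_def
  have hf : ∀ x, HasDerivAt f (p x) x := fun x => by
    have := (hφ.hasDerivAt (Real.exp_pos x)).comp x (Real.hasDerivAt_exp x)
    rwa [mul_comm] at this
  have hf0 : ∀ x, 0 < f x := fun x => hφ.pos (Real.exp_pos x)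
  have hp0 : ∀ x, 0 < p x := fun x => mul_pos (Real.exp_pos x) (hφ.deriv_pos _ (Real.exp_pos x))
  have hpc : Continuous p := Real.continuous_exp.mul
    (hφ.continuousOn_deriv.comp_continuous Real.continuous_exp Real.exp_pos)
  have hfc : Continuous f := continuous_iff_continuousAt.2 fun x => (hf x).continuousAt
  have hlim : Tendsto f atBot (𝓝 0) := by
    have h1 : Tendsto φ (𝓝[Ici 0] 0) (𝓝 0) := by
      have := hφ.continuousOn 0 self_mem_Ici
      rwa [ContinuousWithinAt, hφ.map_zero] at this
    exact h1.comp (tendsto_nhdsWithin_iff.2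
      ⟨Real.tendsto_exp_atBot, Eventually.of_forall fun x => (Real.exp_pos x).le⟩)
  have hint := tendsto_integral_div_add_atBot hf hf0 hp0 hpc
    (fun y x hyx => hD _ _ (Real.exp_pos y) (Real.exp_le_exp.2 hyx)) hlim
  have hden : ∀ s, 0 < p s + f s := fun s => add_pos (hp0 s) (hf0 s)
  set κ : ℝ → ℝ := fun s => p s / (p s + f s) with hκ
  have hκc : Continuous κ := hpc.div (hpc.add hfc) fun s => (hden s).ne'
  -- Freezing κ beyond 0 makes Ψ a bijection of ℝ; only values X ≤ 0 matter for y ≤ b.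
  set g : ℝ → ℝ := fun s => κ (min s 0) with hg_def
  have hgc : Continuous g := hκc.comp (continuous_id.min continuous_const)
  have hg0 : ∀ s, 0 < g s := fun s => div_pos (hp0 _) (hden _)
  set Ψ : ℝ → ℝ := fun x => ∫ s in (0 : ℝ)..x, g s with hΨ
  have hΨd : ∀ x, HasDerivAt Ψ (g x) x := fun x =>
    intervalIntegral.integral_hasDerivAt_right (hgc.intervalIntegrable _ _)
      (hgc.stronglyMeasurableAtFilter _ _) hgc.continuousAt
  have hbot : Tendsto Ψ atBot atBot := by
    refine hint.congr' ?_
    filter_upwards [eventually_le_atBot 0] with x hx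
    refine intervalIntegral.integral_congr fun s hs => ?_
    rw [uIcc_of_ge hx] at hs
    simp [hg_def, hκ, min_eq_left hs.2]
  have htop : Tendsto Ψ atTop atTop := by
    refine (tendsto_id.atTop_mul_const (hg0 0)).congr' ?_
    filter_upwards [eventually_ge_atTop 0] with x hx
    have : Ψ x = ∫ s in (0 : ℝ)..x, g 0 := by
      refine intervalIntegral.integral_congr fun s hs => ?_
      rw [uIcc_of_le hx] at hs
      simp [hg_def, min_eq_right hs.1]
    rw [this]
    simp
  obtain ⟨X, hX, hXm, hXc, hXd⟩ := exists_hasDerivAt_inverse_of_pos hg0 hΨd htop hbot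
  -- The constant c is fixed by X = x₁ at y = b; x₁ ≤ log δ gives θ ≤ δ, and x₁ ≤ 0 keeps X where g
  -- = κ.
  set x₁ : ℝ := min (Real.log δ) 0 with hx₁
  set c : ℝ := M * b - Ψ x₁ with hc
  have hΨm : StrictMono Ψ := strictMono_of_hasDerivAt_pos hΨd hg0
  have hXle : ∀ y ≤ b, X (M * y - c) ≤ x₁ := by
    intro y hy
    rw [← hΨm.le_iff_le, hX]
    have : M * y ≤ M * b := by gcongr
    linarith
  have hin : ∀ y, HasDerivAt (fun y => M * y - c) M y := fun y => by
    simpa using ((hasDerivAt_id y).const_mul M).sub_const c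
  have hθd : ∀ y, HasDerivAt (fun y => Real.exp (X (M * y - c)))
      (Real.exp (X (M * y - c)) * ((g (X (M * y - c)))⁻¹ * M)) y := fun y =>
    ((hXd (M * y - c)).comp y (hin y)).exp
  refine ⟨fun y => Real.exp (X (M * y - c)), ?_, fun y => Real.exp_pos _, fun y hy => ?_,
    fun y hy => ?_⟩
  · rw [contDiff_one_iff_deriv]
    refine ⟨fun y => (hθd y).differentiableAt, ?_⟩
    rw [show deriv (fun y => Real.exp (X (M * y - c))) = _ from funext fun y => (hθd y).deriv]
    have h1 : Continuous fun y => X (M * y - c) := hXc.comp (by fun_prop)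
    exact (Real.continuous_exp.comp h1).mul
      (((hgc.comp h1).inv₀ fun y => (hg0 _).ne').mul continuous_const)
  · exact (Real.le_log_iff_exp_le hδ).1 ((hXle y hy).trans (min_le_left _ _))
  · rw [(hθd y).deriv]
    have h0 : X (M * y - c) ≤ 0 := (hXle y hy).trans (min_le_right _ _)
    simp only [hg_def, hκ, min_eq_left h0, hp_def, hf_def]
    have h1 := hφ.deriv_pos _ (Real.exp_pos (X (M * y - c)))
    have h2 := Real.exp_pos (X (M * y - c))
    rw [inv_div]
    field_simp

end Structural

/-! ### From smooth to C¹ test functions -/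

section Mollification

variable {E : Type*} [NormedAddCommGroup E] [NormedSpace ℝ E] [FiniteDimensional ℝ E]
  [MeasurableSpace E] [BorelSpace E] {μ : Measure E} [μ.IsAddHaarMeasure]

open scoped Convolution Pointwise in
-- Convolve with a bump whose radius is below both δ and the modulus of uniform continuity of the
-- derivative; the derivative falls on ζ.
theorem exists_smooth_approx_fderiv {ζ : E → ℝ} (hζ : ContDiff ℝ 1 ζ) (hζc : HasCompactSupport ζ)
    (hζ0 : ∀ q, 0 ≤ ζ q) {δ ε : ℝ} (hδ : 0 < δ) (hε : 0 < ε) :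
    ∃ ζ' : E → ℝ, ContDiff ℝ ∞ ζ' ∧ tsupport ζ' ⊆ Metric.cthickening δ (tsupport ζ) ∧
      (∀ q, 0 ≤ ζ' q) ∧ ∀ q v, |fderiv ℝ ζ' q v - fderiv ℝ ζ q v| ≤ ε * ‖v‖ := by
  borelize E
  let μ : Measure E := Measure.addHaar
  have hdc : Continuous (fderiv ℝ ζ) := hζ.continuous_fderiv one_ne_zero
  obtain ⟨r, hr, hr'⟩ := Metric.uniformContinuous_iff.1
    ((hζc.fderiv ℝ).uniformContinuous_of_continuous hdc) ε hε
  let b : ContDiffBump (0 : E) :=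
    ⟨min δ r / 2, min δ r, by positivity, half_lt_self (by positivity)⟩
  have hbl : LocallyIntegrable (b.normed μ) μ := b.continuous_normed.locallyIntegrable
  refine ⟨b.normed μ ⋆[ContinuousLinearMap.lsmul ℝ ℝ, μ] ζ, ?_, ?_, ?_, ?_⟩
  · exact b.hasCompactSupport_normed.contDiff_convolution_left _ b.contDiff_normed
      hζ.continuous.locallyIntegrable
  · refine closure_minimal ?_ Metric.isClosed_cthickening
    refine (support_convolution_subset _).trans ?_
    rintro _ ⟨x, hx, y, hy, rfl⟩
    rw [b.support_normed_eq, mem_ball_zero_iff] at hx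
    refine Metric.mem_cthickening_of_dist_le _ y _ _ (subset_tsupport _ hy) ?_
    simpa using hx.le.trans (min_le_left _ _)
  · intro q
    rw [MeasureTheory.convolution_def]
    exact integral_nonneg fun t => mul_nonneg (b.nonneg_normed t) (hζ0 _)
  · intro q v
    rw [(hζc.hasFDerivAt_convolution_right _ hbl hζ q).fderiv,
      convolution_precompR_apply _ hbl (hζc.fderiv ℝ) hdc, ← Real.dist_eq]
    refine b.dist_normed_convolution_le (by fun_prop) fun x hx => ?_
    have h1 : dist (fderiv ℝ ζ x) (fderiv ℝ ζ q) ≤ ε :=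
      (hr' (lt_of_lt_of_le hx (min_le_right _ _))).le
    rw [Real.dist_eq, ← sub_apply, ← Real.norm_eq_abs]
    rw [dist_eq_norm] at h1
    exact ContinuousLinearMap.le_of_opNorm_le _ h1 v

/-- A distributional differential inequality with continuous coefficients may be tested with
functions of class `C¹`. -/
theorem setIntegral_fderiv_nonpos_of_contDiff_one {Ω : Set E} (hΩ : IsOpen Ω) {W : E → E}
    (hW : ContinuousOn W Ω)
    (h : ∀ ζ : E → ℝ, ContDiff ℝ ∞ ζ → HasCompactSupport ζ → tsupport ζ ⊆ Ω → (∀ q, 0 ≤ ζ q) →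
      ∫ q in Ω, fderiv ℝ ζ q (W q) ∂μ ≤ 0)
    {ζ : E → ℝ} (hζ : ContDiff ℝ 1 ζ) (hζc : HasCompactSupport ζ) (hζΩ : tsupport ζ ⊆ Ω)
    (hζ0 : ∀ q, 0 ≤ ζ q) : ∫ q in Ω, fderiv ℝ ζ q (W q) ∂μ ≤ 0 := by
  obtain ⟨δ, hδ, hδΩ⟩ := hζc.isCompact.exists_cthickening_subset_open hΩ hζΩ
  set K := Metric.cthickening δ (tsupport ζ) with hK_def
  have hK : IsCompact K := hζc.isCompact.cthickening
  have hWK := hW.mono hδΩ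
  obtain ⟨C, hC⟩ := hK.exists_bound_of_continuousOn hWK
  have hcont : ∀ f : E → ℝ, ContDiff ℝ 1 f → IntegrableOn (fun q => fderiv ℝ f q (W q)) K μ :=
    fun f hf => ((hf.continuous_fderiv one_ne_zero).continuousOn.clm_apply hWK).integrableOn_compact
      hK
  have hloc : ∀ f : E → ℝ, tsupport f ⊆ K →
      ∫ q in Ω, fderiv ℝ f q (W q) ∂μ = ∫ q in K, fderiv ℝ f q (W q) ∂μ := fun f hf =>
    setIntegral_eq_of_subset_of_forall_sdiff_eq_zero hΩ.measurableSet hδΩ fun q hq => by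
      rw [fderiv_of_notMem_tsupport (𝕜 := ℝ) fun hq' => hq.2 (hf hq')]
      rfl
  have hsub : tsupport ζ ⊆ K := Metric.self_subset_cthickening _
  rw [hloc ζ hsub]
  refine le_of_forall_pos_le_add fun ε hε => ?_
  have hpos : 0 < max C 0 * μ.real K + 1 := by positivity
  obtain ⟨ζ', h1, h2, h3, h4⟩ := exists_smooth_approx_fderiv hζ hζc hζ0 hδ (div_pos hε hpos)
  have h5 := h ζ' h1 (hK.of_isClosed_subset (isClosed_tsupport _) h2) (h2.trans hδΩ) h3
  rw [hloc ζ' h2] at h5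
  have h6 : ‖∫ q in K, (fderiv ℝ ζ' q (W q) - fderiv ℝ ζ q (W q)) ∂μ‖ ≤
      (ε / (max C 0 * μ.real K + 1) * max C 0) * μ.real K := by
    refine norm_setIntegral_le_of_norm_le_const hK.measure_lt_top fun q hq => ?_
    refine (h4 q (W q)).trans ?_
    gcongr
    exact (hC q hq).trans (le_max_left _ _)
  rw [integral_sub (hcont ζ' (h1.of_le (by simp))) (hcont ζ hζ), Real.norm_eq_abs] at h6
  have h7 : (ε / (max C 0 * μ.real K + 1) * max C 0) * μ.real K ≤ ε := by
    rw [mul_assoc, div_mul_eq_mul_div, div_le_iff₀ hpos]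
    nlinarith
  have h8 := (abs_le.1 h6).1
  linarith

/-- The affine coefficient is constant along v, so integration by parts leaves nothing. -/
theorem integral_clm_mul_fderiv_eq_zero {g : E → ℝ} (hg : ContDiff ℝ 1 g)
    (hgc : HasCompactSupport g) {v : E} (ℓ : E →L[ℝ] ℝ) (c : ℝ) (hℓ : ℓ v = 0) :
    ∫ q, (ℓ q + c) * fderiv ℝ g q v ∂μ = 0 := by
  have hcg := hg.continuous
  have hcg' : Continuous fun q => fderiv ℝ g q v :=
    (hg.continuous_fderiv one_ne_zero).clm_apply continuous_const
  rw [integral_mul_fderiv_eq_neg_fderiv_mul_of_integrable]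
  · simp [hℓ]
  · simp [hℓ]
  · exact Continuous.integrable_of_hasCompactSupport (by fun_prop) (hgc.fderiv_apply ℝ v).mul_left
  · exact Continuous.integrable_of_hasCompactSupport (by fun_prop) hgc.mul_left
  · intro x _
    fun_prop
  · intro x _
    exact (hg.differentiable one_ne_zero) x

end Mollification

/-! ### The horizontal frame -/

section Frame

variable {m : ℕ}

instance heis_isAddHaarMeasure_volume : (volume : Measure (Heis m)).IsAddHaarMeasure := by
  have : ((volume : Measure (Fin m → ℝ)).prod (volume : Measure ℝ)).IsAddHaarMeasure :=
    Measure.prod.instIsAddHaarMeasure _ _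
  exact Measure.prod.instIsAddHaarMeasure (volume : Measure (Fin m → ℝ))
    ((volume : Measure (Fin m → ℝ)).prod (volume : Measure ℝ))

/-- The horizontal frame `X_1, …, X_m, Y_1, …, Y_m`. -/
def heisFrame (i : Fin m ⊕ Fin m) (q : Heis m) : Heis m :=
  Sum.elim (fun j => heisX j q) (fun j => heisY j q) i

/-- The horizontal vector at `q` with components `a` in the frame `heisFrame`. -/
noncomputable def heisHor (q : Heis m) (a : EuclideanSpace ℝ (Fin m ⊕ Fin m)) : Heis m :=
  ∑ i, a i • heisFrame i q

theorem heisGrad_apply (u : Heis m → ℝ) (q : Heis m) (i : Fin m ⊕ Fin m) :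
    heisGrad u q i = fderiv ℝ u q (heisFrame i q) := by
  rcases i with j | j <;> rfl

theorem inner_heisGrad (a : EuclideanSpace ℝ (Fin m ⊕ Fin m)) (u : Heis m → ℝ) (q : Heis m) :
    inner ℝ a (heisGrad u q) = fderiv ℝ u q (heisHor q a) := by
  simp [heisHor, PiLp.inner_apply, heisGrad_apply, mul_comm]

theorem heisHor_eq (q : Heis m) (a : EuclideanSpace ℝ (Fin m ⊕ Fin m)) :
    heisHor q a = (fun j => a (Sum.inl j), fun j => a (Sum.inr j),
      2 * ∑ j, (q.2.1 j * a (Sum.inl j) - q.1 j * a (Sum.inr j))) := by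
  refine Prod.ext ?_ (Prod.ext ?_ ?_)
  · funext k
    simp [heisHor, heisFrame, heisX, heisY, Prod.fst_sum, Pi.single_apply]
  · funext k
    simp [heisHor, heisFrame, heisX, heisY, Prod.fst_sum, Prod.snd_sum, Pi.single_apply]
  · simp only [heisHor, heisFrame, heisX, heisY, Prod.snd_sum, Fintype.sum_sum_type, Sum.elim_inl,
      Sum.elim_inr, Prod.snd_add, Prod.smul_snd, smul_eq_mul, Finset.mul_sum, Finset.sum_sub_distrib,
      mul_sub]
    rw [sub_eq_add_neg, ← Finset.sum_neg_distrib]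
    congr 1 <;> exact Finset.sum_congr rfl fun j _ => by ring

theorem contDiff_heisFrame (i : Fin m ⊕ Fin m) : ContDiff ℝ ∞ (heisFrame i : Heis m → Heis m) := by
  rcases i with j | j
  · change ContDiff ℝ ∞ fun q : Heis m => heisX j q
    unfold heisX
    fun_prop
  · change ContDiff ℝ ∞ fun q : Heis m => heisY j q
    unfold heisY
    fun_prop

/-- The fields of the frame are divergence free: each is a constant field plus ℓ(q)∂/∂t with ℓ
independent of t. -/
theorem integral_fderiv_heisFrame {g : Heis m → ℝ} (hg : ContDiff ℝ 1 g)
    (hgc : HasCompactSupport g) (i : Fin m ⊕ Fin m) :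
    ∫ q, fderiv ℝ g q (heisFrame i q) = 0 := by
  have key : ∀ (c : Heis m) (ℓ : Heis m →L[ℝ] ℝ), ℓ (0, 0, 1) = 0 →
      ∫ q, fderiv ℝ g q (c + ℓ q • (0, 0, 1)) = 0 := by
    intro c ℓ hℓ
    have h1 := integral_clm_mul_fderiv_eq_zero (μ := volume) hg hgc (v := c) 0 1 rfl
    have h2 := integral_clm_mul_fderiv_eq_zero (μ := volume) hg hgc ℓ 0 hℓ
    have hc : ∀ v, Continuous fun q => fderiv ℝ g q v := fun v =>
      (hg.continuous_fderiv one_ne_zero).clm_apply continuous_const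
    simp only [zero_apply, zero_add, one_mul, add_zero] at h1 h2
    simp only [map_add, map_smul, smul_eq_mul]
    rw [integral_add, h1, h2, add_zero]
    · exact (hc c).integrable_of_hasCompactSupport (hgc.fderiv_apply ℝ c)
    · exact (ℓ.continuous.mul (hc _)).integrable_of_hasCompactSupport
        (hgc.fderiv_apply ℝ _).mul_left
  rcases i with j | j
  · let ℓ : Heis m →L[ℝ] ℝ := (2 : ℝ) • ((ContinuousLinearMap.proj j).comp
      ((ContinuousLinearMap.fst ℝ (Fin m → ℝ) ℝ).comp
        (ContinuousLinearMap.snd ℝ (Fin m → ℝ) ((Fin m → ℝ) × ℝ))))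
    rw [← key (Pi.single j 1, 0, 0) ℓ (by simp [ℓ])]
    refine integral_congr_ae (Eventually.of_forall fun q => congrArg (fderiv ℝ g q) ?_)
    simp [heisFrame, heisX, ℓ]
  · let ℓ : Heis m →L[ℝ] ℝ := (-2 : ℝ) • ((ContinuousLinearMap.proj j).comp
      (ContinuousLinearMap.fst ℝ (Fin m → ℝ) ((Fin m → ℝ) × ℝ)))
    rw [← key (0, Pi.single j 1, 0) ℓ (by simp [ℓ])]
    refine integral_congr_ae (Eventually.of_forall fun q => congrArg (fderiv ℝ g q) ?_)
    simp [heisFrame, heisY, ℓ]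

theorem ContDiff.heisGrad {w : Heis m → ℝ} (hw : ContDiff ℝ ∞ w) :
    ContDiff ℝ ∞ (heisGrad w) := by
  rw [contDiff_euclidean]
  intro i
  simp only [heisGrad_apply]
  exact (hw.fderiv_right (m := ∞) (by simp)).clm_apply (contDiff_heisFrame i)

theorem ContDiffOn.continuousOn_heisGrad {u : Heis m → ℝ} {Ω : Set (Heis m)} (hΩ : IsOpen Ω)
    (hu : ContDiffOn ℝ 1 u Ω) : ContinuousOn (heisGrad u) Ω := by
  refine (PiLp.continuous_toLp 2 _).comp_continuousOn (continuousOn_pi.2 fun i => ?_)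
  have h := (hu.continuousOn_fderiv_of_isOpen hΩ le_rfl).clm_apply
    (contDiff_heisFrame i).continuous.continuousOn
  rcases i with j | j <;> exact h

end Frame

/-! ### Continuity and monotonicity of the flux map -/

section Flux

variable {V : Type*} [NormedAddCommGroup V] [InnerProductSpace ℝ V] {φ : ℝ → ℝ}

theorem norm_fluxMap (hφ : PhiStructural φ) (a : V) : ‖(‖a‖⁻¹ * φ ‖a‖) • a‖ = φ ‖a‖ := by
  rcases eq_or_ne a 0 with rfl | ha
  · simp [hφ.map_zero]
  · have h := norm_pos_iff.2 ha
    rw [norm_smul, norm_mul, norm_inv, norm_norm, Real.norm_of_nonneg (hφ.pos h).le]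
    field_simp

theorem continuous_fluxMap (hφ : PhiStructural φ) :
    Continuous fun a : V => (‖a‖⁻¹ * φ ‖a‖) • a := by
  have hφn : Continuous fun a : V => φ ‖a‖ :=
    hφ.continuousOn.comp_continuous continuous_norm fun a => norm_nonneg a
  rw [continuous_iff_continuousAt]
  intro a
  rcases eq_or_ne a 0 with rfl | ha
  · rw [ContinuousAt, smul_zero, tendsto_zero_iff_norm_tendsto_zero]
    simp only [norm_fluxMap hφ]
    simpa [hφ.map_zero] using hφn.tendsto 0
  · exact ((continuous_norm.continuousAt.inv₀ (norm_ne_zero_iff.2 ha)).mul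
      hφn.continuousAt).smul continuousAt_id

/-- The flux map `a ↦ |a|⁻¹ φ(|a|) a` is monotone. -/
theorem inner_fluxMap_sub_nonneg (hφ : PhiStructural φ) (a b : V) :
    0 ≤ inner ℝ ((‖a‖⁻¹ * φ ‖a‖) • a - (‖b‖⁻¹ * φ ‖b‖) • b) (a - b) := by
  have hself : ∀ c : V, inner ℝ ((‖c‖⁻¹ * φ ‖c‖) • c) c = φ ‖c‖ * ‖c‖ := by
    intro c
    rcases eq_or_ne c 0 with rfl | hc
    · simp
    · have h := norm_pos_iff.2 hc
      rw [real_inner_smul_left, real_inner_self_eq_norm_sq]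
      field_simp
  -- By Cauchy–Schwarz the pairing is at least (φ(|a|) - φ(|b|))(|a| - |b|).
  have h1 : inner ℝ ((‖a‖⁻¹ * φ ‖a‖) • a) b ≤ φ ‖a‖ * ‖b‖ := by
    simpa [norm_fluxMap hφ] using real_inner_le_norm ((‖a‖⁻¹ * φ ‖a‖) • a) b
  have h2 : inner ℝ ((‖b‖⁻¹ * φ ‖b‖) • b) a ≤ φ ‖b‖ * ‖a‖ := by
    simpa [norm_fluxMap hφ] using real_inner_le_norm ((‖b‖⁻¹ * φ ‖b‖) • b) a
  have h3 : 0 ≤ (φ ‖a‖ - φ ‖b‖) * (‖a‖ - ‖b‖) := by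
    have hm := hφ.strictMonoOn.monotoneOn
    rcases le_total ‖a‖ ‖b‖ with h | h
    · exact mul_nonneg_of_nonpos_of_nonpos
        (sub_nonpos.2 (hm (norm_nonneg a) (norm_nonneg b) h)) (sub_nonpos.2 h)
    · exact mul_nonneg (sub_nonneg.2 (hm (norm_nonneg b) (norm_nonneg a) h)) (sub_nonneg.2 h)
  rw [inner_sub_left, inner_sub_right, inner_sub_right, hself, hself]
  linarith

end Flux

/-! ### Test functions adapted to a superlevel set -/

theorem PhiLaplacianNonneg.setIntegral_nonpos {m : ℕ} {φ : ℝ → ℝ} {Ω : Set (Heis m)}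
    {u : Heis m → ℝ} (h : PhiLaplacianNonneg φ Ω u) (hφ : PhiStructural φ) (hΩ : IsOpen Ω)
    (hu : ContDiffOn ℝ 1 u Ω) {ζ : Heis m → ℝ} (hζ : ContDiff ℝ 1 ζ) (hζc : HasCompactSupport ζ)
    (hζΩ : tsupport ζ ⊆ Ω) (hζ0 : ∀ q, 0 ≤ ζ q) :
    ∫ q in Ω, inner ℝ (heisFlux φ u q) (heisGrad ζ q) ≤ 0 := by
  have hflux : ContinuousOn (heisFlux φ u) Ω :=
    (continuous_fluxMap hφ).comp_continuousOn (hu.continuousOn_heisGrad hΩ)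
  have hW : ContinuousOn (fun q => heisHor q (heisFlux φ u q)) Ω := by
    refine continuousOn_finsetSum _ fun i _ => ?_
    exact ((EuclideanSpace.proj i).continuous.comp_continuousOn hflux).smul
      (contDiff_heisFrame i).continuous.continuousOn
  simp only [inner_heisGrad]
  refine setIntegral_fderiv_nonpos_of_contDiff_one hΩ hW (fun ζ h1 h2 h3 h4 => ?_) hζ hζc hζΩ hζ0
  have := h ζ h1 h2 h3 h4
  simp only [inner_heisGrad] at this
  linarith

theorem contDiff_of_forall_mem_tsupport {E F : Type*} [NormedAddCommGroup E] [NormedSpace ℝ E]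
    [NormedAddCommGroup F] [NormedSpace ℝ F] {n : WithTop ℕ∞} {f : E → F}
    (h : ∀ q ∈ tsupport f, ContDiffAt ℝ n f q) : ContDiff ℝ n f :=
  contDiff_iff_contDiffAt.2 fun q => by
    by_cases hq : q ∈ tsupport f
    · exact h q hq
    · exact contDiffAt_const.congr_of_eventuallyEq (notMem_tsupport_iff_eventuallyEq.1 hq)

/-- A smooth substitute for the positive part: `expNegInvGlue` is nondecreasing and vanishes exactly
on (-∞, 0], so `expNegInvGlue ∘ g` is C¹ and its gradient is a nonnegative multiple of that of g. -/
theorem exists_test_function {E : Type*} [NormedAddCommGroup E] [NormedSpace ℝ E] {B K : Set E}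
    (hB : IsOpen B) (hK : IsClosed K) (hKB : K ⊆ B) {g : E → ℝ} (hg : ContDiffOn ℝ 1 g B)
    (hgK : ∀ q ∈ B, 0 < g q → q ∈ K) :
    ∃ ζ : E → ℝ, ContDiff ℝ 1 ζ ∧ tsupport ζ ⊆ K ∧ (∀ q, 0 ≤ ζ q) ∧
      (∀ q ∈ B, 0 < g q → 0 < ζ q) ∧ ∀ q ∈ B, ∃ c : ℝ, 0 ≤ c ∧ fderiv ℝ ζ q = c • fderiv ℝ g q := by
  set ζ : E → ℝ := B.indicator fun q => expNegInvGlue (g q) with hζ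
  have heq : ∀ q ∈ B, ζ =ᶠ[𝓝 q] fun q => expNegInvGlue (g q) := fun q hq => by
    filter_upwards [hB.mem_nhds hq] with p hp
    exact indicator_of_mem hp _
  have hsupp : tsupport ζ ⊆ K := by
    refine closure_minimal (fun q hq => ?_) hK
    have hqB : q ∈ B := mem_of_indicator_ne_zero hq
    refine hgK q hqB (not_le.1 fun h => hq ?_)
    rw [hζ, indicator_of_mem hqB, expNegInvGlue.zero_of_nonpos h]
  have hgat : ∀ q ∈ B, ContDiffAt ℝ 1 g q := fun q hq => hg.contDiffAt (hB.mem_nhds hq)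
  refine ⟨ζ, contDiff_of_forall_mem_tsupport fun q hq => ?_, hsupp, fun q => ?_, fun q hq hgq => ?_,
    fun q hq => ?_⟩
  · have hqB := hKB (hsupp hq)
    exact (expNegInvGlue.contDiff.contDiffAt.comp q (hgat q hqB)).congr_of_eventuallyEq (heq q hqB)
  · exact indicator_nonneg (fun _ _ => expNegInvGlue.nonneg _) q
  · rw [hζ, indicator_of_mem hq]
    exact expNegInvGlue.pos_of_pos hgq
  · refine ⟨deriv expNegInvGlue (g q), expNegInvGlue.monotone.deriv_nonneg, ?_⟩
    rw [(heq q hq).fderiv_eq]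
    have h1 : HasDerivAt expNegInvGlue (deriv expNegInvGlue (g q)) (g q) :=
      ((expNegInvGlue.contDiff (n := 1)).differentiable (by simp) _).hasDerivAt
    exact (h1.comp_hasFDerivAt q ((hgat q hq).differentiableAt one_ne_zero).hasFDerivAt).fderiv

/-! ### Comparison principle -/

section Comparison

variable {m : ℕ} {φ : ℝ → ℝ} {Ω : Set (Heis m)} {u : Heis m → ℝ}

theorem heisGrad_eq_smul {u v : Heis m → ℝ} {q : Heis m} {c : ℝ}
    (h : fderiv ℝ u q = c • fderiv ℝ v q) : heisGrad u q = c • heisGrad v q := by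
  ext i
  simp [heisGrad_apply, h]

/-- S is the horizontal divergence of ζf, with integral 0 because the frame is divergence free. It
is given as a function on the whole group since f is regular only on B. -/
theorem integral_div_smul_eq_zero {B : Set (Heis m)} (hB : IsOpen B)
    {f : Heis m → EuclideanSpace ℝ (Fin m ⊕ Fin m)} (hf : ContDiffOn ℝ 1 f B) {ζ : Heis m → ℝ}
    (hζ : ContDiff ℝ 1 ζ) (hζc : HasCompactSupport ζ) (hζB : tsupport ζ ⊆ B) :
    ∃ S : Heis m → ℝ, Integrable S ∧ ∫ q, S q = 0 ∧ (∀ q, q ∉ tsupport ζ → S q = 0) ∧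
      ∀ q ∈ B, S q = inner ℝ (f q) (heisGrad ζ q) +
        ζ q * ∑ i, fderiv ℝ (fun p => f p i) q (heisFrame i q) := by
  have hfi : ∀ i, ∀ q ∈ B, ContDiffAt ℝ 1 (fun p => f p i) q := fun i q hq =>
    (contDiffAt_euclidean.1 (hf.contDiffAt (hB.mem_nhds hq))) i
  have hsub : ∀ i, tsupport (fun q => f q i * ζ q) ⊆ tsupport ζ := fun i =>
    tsupport_mul_subset_right
  have hC : ∀ i, ContDiff ℝ 1 fun q => f q i * ζ q := fun i =>
    contDiff_of_forall_mem_tsupport fun q hq => (hfi i q (hζB (hsub i hq))).mul hζ.contDiffAt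
  have hc : ∀ i, HasCompactSupport fun q => f q i * ζ q := fun i => hζc.mul_left
  have hint : ∀ i, Integrable fun q => fderiv ℝ (fun q => f q i * ζ q) q (heisFrame i q) := by
    intro i
    refine Continuous.integrable_of_hasCompactSupport
      (((hC i).continuous_fderiv one_ne_zero).clm_apply (contDiff_heisFrame i).continuous) ?_
    refine ((hc i).fderiv ℝ).mono fun q hq => ?_
    simp only [Function.mem_support, ne_eq] at hq ⊢
    exact fun h => hq (by rw [h]; rfl)
  refine ⟨fun q => ∑ i, fderiv ℝ (fun q => f q i * ζ q) q (heisFrame i q),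
    integrable_finsetSum _ fun i _ => hint i, ?_, fun q hq => ?_, fun q hq => ?_⟩
  · rw [integral_finsetSum _ fun i _ => hint i]
    exact Finset.sum_eq_zero fun i _ => integral_fderiv_heisFrame (hC i) (hc i) i
  · refine Finset.sum_eq_zero fun i _ => ?_
    rw [fderiv_of_notMem_tsupport (𝕜 := ℝ) fun h => hq (hsub i h)]
    rfl
  · rw [PiLp.inner_apply, Finset.mul_sum, ← Finset.sum_add_distrib]
    refine Finset.sum_congr rfl fun i _ => ?_
    rw [fderiv_fun_mul ((hfi i q hq).differentiableAt one_ne_zero)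
      (hζ.differentiable one_ne_zero q)]
    simp [heisGrad_apply, mul_comm]

/-- Comparison of a weak subsolution `u` with the strict supersolution `c - h`. -/
theorem PhiLaplacianNonneg.comparison (hφ : PhiStructural φ) (hΩ : IsOpen Ω)
    (hu : ContDiffOn ℝ 1 u Ω) (hsub : PhiLaplacianNonneg φ Ω u) {B K : Set (Heis m)}
    (hB : IsOpen B) (hBΩ : B ⊆ Ω) (hK : IsCompact K) (hKB : K ⊆ B) {h : Heis m → ℝ}
    (hh : ContDiffOn ℝ 1 h B) (hflux : ContDiffOn ℝ 1 (heisFlux φ h) B)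
    (hdiv : ∀ q ∈ B, 0 < ∑ i, fderiv ℝ (fun p => heisFlux φ h p i) q (heisFrame i q)) {c : ℝ}
    (hcK : ∀ q ∈ B, c < u q + h q → q ∈ K) : ∀ q ∈ B, u q + h q ≤ c := by
  by_contra! hcon
  obtain ⟨q₁, hq₁, hcq⟩ := hcon
  have huB := hu.mono hBΩ
  obtain ⟨ζ, hζ, hζK, hζ0, hζpos, hζd⟩ := exists_test_function (g := fun q => u q + h q - c) hB
    hK.isClosed hKB ((huB.add hh).sub contDiffOn_const) fun q hq hq' => hcK q hq (by linarith)
  have hζB := hζK.trans hKB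
  have hζc : HasCompactSupport ζ := hK.of_isClosed_subset (isClosed_tsupport _) hζK
  have hweak := hsub.setIntegral_nonpos hφ hΩ hu hζ hζc (hζB.trans hBΩ) hζ0
  obtain ⟨S, hSi, hS0, hSsupp, hS⟩ := integral_div_smul_eq_zero hB hflux hζ hζc hζB
  set d : Heis m → ℝ := fun q =>
    ∑ i, fderiv ℝ (fun p => heisFlux φ h p i) q (heisFrame i q) with hd
  have hgrad0 : ∀ q, q ∉ tsupport ζ → heisGrad ζ q = 0 := fun q hq => by
    ext i
    rw [heisGrad_apply, fderiv_of_notMem_tsupport (𝕜 := ℝ) hq]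
    rfl
  have hF0 : ∀ q, q ∉ tsupport ζ → inner ℝ (heisFlux φ u q) (heisGrad ζ q) = 0 := fun q hq => by
    rw [hgrad0 q hq, inner_zero_right]
  have hFt : tsupport (fun q => inner ℝ (heisFlux φ u q) (heisGrad ζ q)) ⊆ tsupport ζ :=
    closure_minimal (fun q hq => by_contra fun h' => hq (hF0 q h')) (isClosed_tsupport _)
  have hFint : Integrable fun q => inner ℝ (heisFlux φ u q) (heisGrad ζ q) := by
    refine Continuous.integrable_of_hasCompactSupport ?_
      (hζc.isCompact.of_isClosed_subset (isClosed_tsupport _) hFt)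
    refine continuous_of_tsupport fun q hq => ?_
    have hqB := hζB (hFt hq)
    refine (ContinuousOn.inner ((continuous_fluxMap hφ).comp_continuousOn
      (huB.continuousOn_heisGrad hB))
      (hζ.contDiffOn.continuousOn_heisGrad hB)).continuousAt (hB.mem_nhds hqB)
  have hPt : tsupport (fun q => ζ q * d q) ⊆ tsupport ζ := tsupport_mul_subset_left
  have hPcont : Continuous fun q => ζ q * d q := by
    refine continuous_of_tsupport fun q hq => hζ.continuous.continuousAt.mul ?_
    have hqB := hB.mem_nhds (hζB (hPt hq))
    refine ContinuousOn.continuousAt (continuousOn_finsetSum _ fun i _ => ?_) hqB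
    exact ((contDiffOn_euclidean.1 hflux i).continuousOn_fderiv_of_isOpen hB le_rfl).clm_apply
      (contDiff_heisFrame i).continuous.continuousOn
  have hPc : HasCompactSupport fun q => ζ q * d q := hζc.mul_right
  have hPpos : 0 < ∫ q, ζ q * d q := by
    refine hPcont.integral_pos_of_hasCompactSupport_nonneg_nonzero (x := q₁) hPc (fun q => ?_) ?_
    · by_cases hq : q ∈ B
      · exact mul_nonneg (hζ0 q) (hdiv q hq).le
      · simp [image_eq_zero_of_notMem_tsupport fun h' => hq (hζB h')]
    · exact (mul_pos (hζpos q₁ hq₁ (by linarith)) (hdiv q₁ hq₁)).ne'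
  -- The gradient of ζ is a nonnegative multiple of ∇u - ∇(-h) and the flux map is odd, so
  -- monotonicity makes the fluxes of u and h sum to a nonnegative pairing with ∇ζ; the pairing of
  -- the flux of h is S - ζd. Integrating gives 0 < ∫ζd ≤ 0.
  have hle : ∀ q, ζ q * d q - S q ≤ inner ℝ (heisFlux φ u q) (heisGrad ζ q) := by
    intro q
    by_cases hq : q ∈ tsupport ζ
    · have hqB := hζB hq
      obtain ⟨k, hk, hk'⟩ := hζd q hqB
      have hgr : heisGrad (fun q => u q + h q - c) q = heisGrad u q - -heisGrad h q := by
        have hdu := (huB.contDiffAt (hB.mem_nhds hqB)).differentiableAt one_ne_zero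
        have hdh := (hh.contDiffAt (hB.mem_nhds hqB)).differentiableAt one_ne_zero
        ext i
        simp only [heisGrad_apply, fderiv_sub_const, fderiv_fun_add hdu hdh, sub_neg_eq_add,
          PiLp.add_apply, add_apply]
      have hmon := inner_fluxMap_sub_nonneg hφ (heisGrad u q) (-heisGrad h q)
      rw [norm_neg, smul_neg, sub_neg_eq_add, inner_add_left, ← hgr] at hmon
      change 0 ≤ inner ℝ (heisFlux φ u q) _ + inner ℝ (heisFlux φ h q) _ at hmon
      rw [hS q hqB, heisGrad_eq_smul hk', inner_smul_right, inner_smul_right]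
      have := mul_nonneg hk hmon
      linarith
    · rw [hF0 q hq, hSsupp q hq, image_eq_zero_of_notMem_tsupport hq]
      simp
  have hmono := integral_mono ((hPcont.integrable_of_hasCompactSupport hPc).sub hSi) hFint hle
  rw [integral_sub' (hPcont.integrable_of_hasCompactSupport hPc) hSi, hS0, sub_zero] at hmono
  rw [setIntegral_eq_integral_of_forall_compl_eq_zero fun q hq =>
    hF0 q fun h' => hq (hBΩ (hζB h'))] at hweak
  linarith

end Comparison

/-! ### Strict subsolutions of the form η ∘ w -/

section Barrier

variable {m : ℕ} {φ : ℝ → ℝ} {w : Heis m → ℝ}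

/-- Since η' = θ > 0, composition keeps the direction of the gradient: the flux is a scalar Φ times
the unit normal n = ∇w/|∇w|, which depends on w alone. -/
theorem heisFlux_comp {η θ : ℝ → ℝ} (hη : ∀ y, HasDerivAt η (θ y) y) (hθ : ∀ y, 0 < θ y)
    (hw : ContDiff ℝ ∞ w) (q : Heis m) (i : Fin m ⊕ Fin m) :
    heisFlux φ (fun p => η (w p)) q i =
      φ (θ (w q) * ‖heisGrad w q‖) * (‖heisGrad w q‖⁻¹ * heisGrad w q i) := by
  have h1 : heisGrad (fun p => η (w p)) q = θ (w q) • heisGrad w q := heisGrad_eq_smul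
    ((hη (w q)).comp_hasFDerivAt q (hw.differentiable (by simp) q).hasFDerivAt).fderiv
  have h2 := hθ (w q)
  simp only [heisFlux, h1, norm_smul, Real.norm_of_nonneg h2.le, PiLp.smul_apply, smul_eq_mul]
  field_simp

theorem contDiffOn_norm_heisGrad (hw : ContDiff ℝ ∞ w) :
    ContDiffOn ℝ 1 (fun q => ‖heisGrad w q‖) {q | heisGrad w q ≠ 0} :=
  (hw.heisGrad.of_le (by simp)).contDiffOn.norm ℝ fun _ hq => hq

theorem contDiffOn_heisGrad_div_norm (hw : ContDiff ℝ ∞ w) (i : Fin m ⊕ Fin m) :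
    ContDiffOn ℝ 1 (fun q => ‖heisGrad w q‖⁻¹ * heisGrad w q i) {q | heisGrad w q ≠ 0} :=
  ((contDiffOn_norm_heisGrad hw).inv fun _ hq => norm_ne_zero_iff.2 hq).mul
    (contDiffOn_euclidean.1 (hw.heisGrad.of_le (by simp)).contDiffOn i)

theorem contDiffOn_phi_comp (hφ : PhiStructural φ) {θ : ℝ → ℝ} (hθ : ∀ y, 0 < θ y)
    (hθ1 : ContDiff ℝ 1 θ) (hw : ContDiff ℝ ∞ w) :
    ContDiffOn ℝ 1 (fun q => φ (θ (w q) * ‖heisGrad w q‖)) {q | heisGrad w q ≠ 0} :=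
  hφ.contDiffOn.comp ((hθ1.comp (hw.of_le (by simp))).contDiffOn.mul (contDiffOn_norm_heisGrad hw))
    fun _ hq => mul_pos (hθ _) (norm_pos_iff.2 hq)

/-- Composing a smooth function without horizontal critical points with a sufficiently steep
profile gives a strict subsolution. -/
theorem PhiStructural.exists_div_flux_pos (hφ : PhiStructural φ) {D : ℝ} (hD0 : 1 ≤ D)
    (hD : ∀ r t, 0 < r → r ≤ t → r * deriv φ r ≤ D * (t * deriv φ t)) (hw : ContDiff ℝ ∞ w)
    {K : Set (Heis m)} (hK : IsCompact K)
    (hwK : ∀ q ∈ K, 1 ≤ ‖heisGrad w q‖ ∧ ‖heisGrad w q‖ ≤ 3) :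
    ∃ M : ℝ, 0 < M ∧ ∀ η θ : ℝ → ℝ, (∀ y, HasDerivAt η (θ y) y) → ContDiff ℝ 1 θ →
      (∀ y, 0 < θ y) → ∀ q ∈ K,
      deriv θ (w q) = M * (θ (w q) + φ (θ (w q)) / deriv φ (θ (w q))) →
      0 < ∑ i, fderiv ℝ (fun p => heisFlux φ (fun p => η (w p)) p i) q (heisFrame i q) := by
  set U : Set (Heis m) := {q | heisGrad w q ≠ 0} with hU_def
  have hU : IsOpen U := isOpen_ne_fun hw.heisGrad.continuous continuous_const
  have hKU : K ⊆ U := fun q hq h => by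
    have := (hwK q hq).1
    rw [h, norm_zero] at this
    linarith
  set N : Heis m → ℝ := fun q => ‖heisGrad w q‖ with hN_def
  set n : Fin m ⊕ Fin m → Heis m → ℝ := fun i q => ‖heisGrad w q‖⁻¹ * heisGrad w q i with hn_def
  have hN1 : ContDiffOn ℝ 1 N U := contDiffOn_norm_heisGrad hw
  have hn1 : ∀ i, ContDiffOn ℝ 1 (n i) U := contDiffOn_heisGrad_div_norm hw
  have hder : ∀ (f : Heis m → ℝ) (i : Fin m ⊕ Fin m), ContDiffOn ℝ 1 f U →
      ContinuousOn (fun q => fderiv ℝ f q (heisFrame i q)) K := fun f i hf =>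
    ((hf.continuousOn_fderiv_of_isOpen hU le_rfl).clm_apply
      (contDiff_heisFrame i).continuous.continuousOn).mono hKU
  -- C₁ bounds the derivative of N = |∇w| along n, and C₂ the divergence of n.
  obtain ⟨C₁, hC₁⟩ := hK.exists_bound_of_continuousOn
    (f := fun q => ∑ i, fderiv ℝ N q (heisFrame i q) * n i q)
    (continuousOn_finsetSum _ fun i _ => (hder N i hN1).mul ((hn1 i).continuousOn.mono hKU))
  obtain ⟨C₂, hC₂⟩ := hK.exists_bound_of_continuousOn
    (f := fun q => ∑ i, fderiv ℝ (n i) q (heisFrame i q))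
    (continuousOn_finsetSum _ fun i _ => hder (n i) i (hn1 i))
  set C : ℝ := max (max C₁ C₂) 0 with hC_def
  have hC0 : 0 ≤ C := le_max_right _ _
  -- In M, the term C absorbs the derivative of N, 6CD absorbs the divergence of n through
  -- `le_deriv_mul`, and 1 leaves strict positivity.
  refine ⟨C + C * (D * 6) + 1, by positivity, fun η θ hη hθ1 hθ q hq hode => ?_⟩
  have hqU := hKU hq
  have hnh := hU.mem_nhds hqU
  set Φ : Heis m → ℝ := fun q => φ (θ (w q) * ‖heisGrad w q‖) with hΦ_def
  have hΦd : DifferentiableAt ℝ Φ q :=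
    ((contDiffOn_phi_comp hφ hθ hθ1 hw).contDiffAt hnh).differentiableAt one_ne_zero
  have hnd : ∀ i, DifferentiableAt ℝ (n i) q := fun i =>
    ((hn1 i).contDiffAt hnh).differentiableAt one_ne_zero
  have hNd : DifferentiableAt ℝ N q := (hN1.contDiffAt hnh).differentiableAt one_ne_zero
  have hNq : 0 < N q := norm_pos_iff.2 hqU
  have hwd : DifferentiableAt ℝ w q := hw.differentiable (by simp) q
  have hΦ' : ∀ v, fderiv ℝ Φ q v = deriv φ (θ (w q) * N q) *
      (θ (w q) * fderiv ℝ N q v + N q * (deriv θ (w q) * fderiv ℝ w q v)) := by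
    intro v
    have h1 : HasFDerivAt (fun q => θ (w q)) (deriv θ (w q) • fderiv ℝ w q) q :=
      ((hθ1.differentiable one_ne_zero (w q)).hasDerivAt).comp_hasFDerivAt q hwd.hasFDerivAt
    have h2 := (hφ.hasDerivAt (mul_pos (hθ (w q)) hNq)).comp_hasFDerivAt q
      (h1.mul hNd.hasFDerivAt)
    have h3 : fderiv ℝ Φ q = _ := h2.fderiv
    rw [h3]
    simp [mul_add]
  have hsumn : ∑ i, fderiv ℝ w q (heisFrame i q) * n i q = N q := by
    have h1 : ∑ i, heisGrad w q i * heisGrad w q i = N q * N q := by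
      rw [← real_inner_self_eq_norm_mul_norm, PiLp.inner_apply]
      rfl
    calc ∑ i, fderiv ℝ w q (heisFrame i q) * n i q
        = (N q)⁻¹ * ∑ i, heisGrad w q i * heisGrad w q i := by
          rw [Finset.mul_sum]
          refine Finset.sum_congr rfl fun i _ => ?_
          rw [← heisGrad_apply]
          ring
      _ = N q := by
          rw [h1]
          field_simp
  have hfl : ∀ i, fderiv ℝ (fun p => heisFlux φ (fun p => η (w p)) p i) q (heisFrame i q) =
      Φ q * fderiv ℝ (n i) q (heisFrame i q) + n i q * fderiv ℝ Φ q (heisFrame i q) := by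
    intro i
    have h1 : (fun p => heisFlux φ (fun p => η (w p)) p i) = fun p => Φ p * n i p :=
      funext fun p => heisFlux_comp hη hθ hw p i
    rw [h1, fderiv_fun_mul hΦd (hnd i)]
    simp
  set t : ℝ := θ (w q) with ht_def
  set φ' : ℝ := deriv φ (t * N q) with hφ'_def
  -- Product rule with Φ = φ(tN): the favourable term is φ'(tN)θ'N², which must dominate the other
  -- two.
  have htot : ∑ i, fderiv ℝ (fun p => heisFlux φ (fun p => η (w p)) p i) q (heisFrame i q) =
      Φ q * ∑ i, fderiv ℝ (n i) q (heisFrame i q) +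
      φ' * (t * ∑ i, fderiv ℝ N q (heisFrame i q) * n i q + N q * deriv θ (w q) * N q) := by
    simp only [hfl, hΦ']
    rw [Finset.sum_add_distrib, ← Finset.mul_sum]
    congr 1
    conv_rhs => rw [← hsumn, Finset.mul_sum, Finset.mul_sum, ← Finset.sum_add_distrib,
      Finset.mul_sum, hsumn]
    exact Finset.sum_congr rfl fun i _ => by ring
  rw [htot]
  have ht : 0 < t := hθ _
  obtain ⟨hN_lo, hN_hi⟩ := hwK q hq
  have hβ := (abs_le.1 ((hC₂ q hq).trans ((le_max_right C₁ C₂).trans (le_max_left _ 0)))).1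
  have hα := (abs_le.1 ((hC₁ q hq).trans ((le_max_left C₁ C₂).trans (le_max_left _ 0)))).1
  have hφ'pos : 0 < φ' := hφ.deriv_pos _ (mul_pos ht hNq)
  have hΦpos : 0 < Φ q := hφ.pos (mul_pos ht hNq)
  set r : ℝ := φ t / deriv φ t with hr_def
  have hr : 0 < r := div_pos (hφ.pos ht) (hφ.deriv_pos t ht)
  have hΦle : Φ q ≤ φ' * (D * (6 * t + 3 * r)) :=
    hφ.le_deriv_mul hD0 hD ht (le_mul_of_one_le_right ht.le hN_lo) (by
      rw [mul_comm]
      exact mul_le_mul_of_nonneg_right hN_hi ht.le)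
  have hθ'pos : 0 ≤ deriv θ (w q) := by
    rw [hode]
    positivity
  have e1 : -(C * (φ' * (D * (6 * t + 3 * r)))) ≤
      Φ q * ∑ i, fderiv ℝ (n i) q (heisFrame i q) := by
    have h1 : Φ q * -C ≤ Φ q * ∑ i, fderiv ℝ (n i) q (heisFrame i q) :=
      mul_le_mul_of_nonneg_left hβ hΦpos.le
    have h2 : C * Φ q ≤ C * (φ' * (D * (6 * t + 3 * r))) := mul_le_mul_of_nonneg_left hΦle hC0
    linarith
  have e2 : -(t * C) ≤ t * ∑ i, fderiv ℝ N q (heisFrame i q) * n i q := by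
    have := mul_le_mul_of_nonneg_left hα ht.le
    linarith
  have e3 : deriv θ (w q) ≤ N q * deriv θ (w q) * N q := by
    have : 1 ≤ N q * N q := by nlinarith
    nlinarith
  have e4 : φ' * (-(t * C) + deriv θ (w q)) ≤
      φ' * (t * ∑ i, fderiv ℝ N q (heisFrame i q) * n i q + N q * deriv θ (w q) * N q) :=
    mul_le_mul_of_nonneg_left (by linarith) hφ'pos.le
  have e5 : 0 < φ' * (C * r + C * D * 3 * r + t + r) := by positivity
  have e6 : φ' * (-(t * C) + deriv θ (w q)) - C * (φ' * (D * (6 * t + 3 * r))) =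
      φ' * (C * r + C * D * 3 * r + t + r) := by
    rw [hode]
    ring
  linarith

end Barrier

/-! ### Boundary point lemma -/

section Touching

variable {m : ℕ}

/-- The square of the Euclidean norm. -/
def heisSq (q : Heis m) : ℝ := ∑ i, q.1 i ^ 2 + ∑ i, q.2.1 i ^ 2 + q.2.2 ^ 2

theorem contDiff_heisSq : ContDiff ℝ ∞ (heisSq : Heis m → ℝ) := by
  unfold heisSq
  fun_prop

theorem heisSq_zero : heisSq (0 : Heis m) = 0 := by simp [heisSq]

theorem heisSq_nonneg (q : Heis m) : 0 ≤ heisSq q := by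
  unfold heisSq
  positivity

theorem heisSq_pos {q : Heis m} (hq : q ≠ 0) : 0 < heisSq q := by
  refine (heisSq_nonneg q).lt_of_ne' fun h => hq ?_
  have h1 : 0 ≤ ∑ i, q.1 i ^ 2 := by positivity
  have h2 : 0 ≤ ∑ i, q.2.1 i ^ 2 := by positivity
  unfold heisSq at h
  have h3 : ∑ i, q.1 i ^ 2 = 0 := by nlinarith
  have h4 : ∑ i, q.2.1 i ^ 2 = 0 := by nlinarith
  have h5 : q.2.2 ^ 2 = 0 := by nlinarith
  rw [Finset.sum_eq_zero_iff_of_nonneg fun i _ => sq_nonneg _] at h3 h4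
  refine Prod.ext (funext fun i => ?_) (Prod.ext (funext fun i => ?_) ?_)
  · simpa using h3 i (Finset.mem_univ i)
  · simpa using h4 i (Finset.mem_univ i)
  · simpa using h5

variable {φ : ℝ → ℝ} {Ω : Set (Heis m)} {u : Heis m → ℝ} {c : ℝ} {q₀ : Heis m}

/-- A boundary point lemma: the horizontal normals of the contact set of a subsolution with its
maximum vanish. -/
theorem PhiLaplacianNonneg.heisGrad_eq_zero_of_touching (hφ : PhiStructural φ)
    (hφ2 : PhiRelaxedHomogeneous φ) (hΩ : IsOpen Ω) (hu : ContDiffOn ℝ 1 u Ω)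
    (hsub : PhiLaplacianNonneg φ Ω u) (hle : ∀ q ∈ Ω, u q ≤ c) (hq₀ : q₀ ∈ Ω) (huq₀ : u q₀ = c)
    {w : Heis m → ℝ} (hw : ContDiff ℝ ∞ w)
    (htouch : ∀ᶠ q in 𝓝 q₀, u q = c → w q ≤ w q₀) : heisGrad w q₀ = 0 := by
  by_contra hne
  obtain ⟨D, hD0, hD⟩ := hφ2.mul_deriv_le hφ
  -- Scaling gives w₁ a horizontal gradient of norm 2 at q₀, hence between 1 and 3 nearby.
  -- Subtracting the squared distance leaves that gradient unchanged and makes q₀ the only nearby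
  -- contact point with w₁ ≥ 0.
  set k : ℝ := 2 / ‖heisGrad w q₀‖ with hk
  have hk0 : 0 < k := div_pos two_pos (norm_pos_iff.2 hne)
  set w₁ : Heis m → ℝ := fun q => k * (w q - w q₀) - heisSq (q - q₀) with hw₁
  have hQ : ContDiff ℝ ∞ fun q : Heis m => heisSq (q - q₀) :=
    contDiff_heisSq.comp (contDiff_id.sub contDiff_const)
  have hw₁s : ContDiff ℝ ∞ w₁ := (contDiff_const.mul (hw.sub contDiff_const)).sub hQ
  have hw₁0 : w₁ q₀ = 0 := by simp [hw₁, heisSq_zero]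
  have hgrad : heisGrad w₁ q₀ = k • heisGrad w q₀ := by
    refine heisGrad_eq_smul ?_
    have h1 : fderiv ℝ (fun q : Heis m => heisSq (q - q₀)) q₀ = 0 := by
      refine IsLocalMin.fderiv_eq_zero (Eventually.of_forall fun q => ?_)
      simp only [sub_self, heisSq_zero]
      exact heisSq_nonneg _
    have hwd : DifferentiableAt ℝ w q₀ := hw.differentiable (by simp) q₀
    rw [hw₁, fderiv_fun_sub ((hwd.sub_const _).const_mul k) (hQ.differentiable (by simp) q₀), h1,
      sub_zero, fderiv_const_mul (hwd.sub_const _), fderiv_sub_const]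
  have hnorm : ‖heisGrad w₁ q₀‖ = 2 := by
    rw [hgrad, norm_smul, Real.norm_of_nonneg hk0.le, hk,
      div_mul_cancel₀ _ (norm_ne_zero_iff.2 hne)]
  have hNc : Continuous fun q => ‖heisGrad w₁ q‖ := hw₁s.heisGrad.continuous.norm
  have hev : ∀ᶠ q in 𝓝 q₀, q ∈ Ω ∧ (1 < ‖heisGrad w₁ q‖ ∧ ‖heisGrad w₁ q‖ < 3) ∧
      (u q = c → w q ≤ w q₀) :=
    (hΩ.eventually_mem hq₀).and (((hNc.continuousAt.eventually (lt_mem_nhds (by norm_num [hnorm]))).and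
      (hNc.continuousAt.eventually (gt_mem_nhds (by norm_num [hnorm])))).and htouch)
  obtain ⟨r, hr, hr'⟩ := Metric.nhds_basis_closedBall.eventually_iff.1 hev
  set K := Metric.closedBall q₀ r with hK_def
  have hK : IsCompact K := isCompact_closedBall _ _
  have hKΩ : K ⊆ Ω := fun q hq => (hr' hq).1
  have hcontact : ∀ q ∈ K, u q = c → 0 ≤ w₁ q → q = q₀ := by
    intro q hq hqc hqw
    by_contra hqne
    have h1 := (hr' hq).2.2 hqc
    have h2 := heisSq_pos (sub_ne_zero.2 hqne)
    have h3 : k * (w q - w q₀) ≤ 0 := mul_nonpos_of_nonneg_of_nonpos hk0.le (by linarith)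
    simp only [hw₁] at hqw
    linarith
  obtain ⟨M, hM, hdiv⟩ := hφ.exists_div_flux_pos hD0 hD hw₁s hK
    fun q hq => ⟨(hr' hq).2.1.1.le, (hr' hq).2.1.2.le⟩
  obtain ⟨b₀, hb₀⟩ := hK.exists_bound_of_continuousOn hw₁s.continuous.continuousOn
  set b : ℝ := max b₀ 1 with hb
  have hb1 : 0 < b := lt_of_lt_of_le one_pos (le_max_right _ _)
  have hbK : ∀ q ∈ K, w₁ q ≤ b := fun q hq =>
    (le_abs_self _).trans ((hb₀ q hq).trans (le_max_left _ _))
  have hucK : ContinuousOn u K := hu.continuousOn.mono hKΩ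
  -- On this part of the sphere there is no contact, so c - u has a positive lower bound δ; on the
  -- rest of the sphere h < 0.
  have hA : IsCompact (Metric.sphere q₀ r ∩ {q | 0 ≤ w₁ q}) :=
    (isCompact_sphere q₀ r).inter_right (isClosed_le continuous_const hw₁s.continuous)
  have hAK : Metric.sphere q₀ r ∩ {q | 0 ≤ w₁ q} ⊆ K :=
    inter_subset_left.trans Metric.sphere_subset_closedBall
  obtain ⟨δ, hδ, hδA⟩ := hA.exists_forall_le' (f := fun q => c - u q) (a := 0)
    (continuousOn_const.sub (hucK.mono hAK)) fun q hq => by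
      have h1 := hle q (hKΩ (hAK hq))
      refine sub_pos.2 (h1.lt_of_ne fun h2 => ?_)
      have h3 := hcontact q (hAK hq) h2 hq.2
      have h4 := hq.1
      rw [h3, Metric.mem_sphere, dist_self] at h4
      exact hr.ne h4
  -- Slope at most δ/b on (-∞, b] makes h = η ∘ w₁ at most δ where 0 ≤ w₁ ≤ b.
  obtain ⟨θ, hθ1, hθ0, hθδ, hode⟩ := hφ.exists_profile hD hM (div_pos hδ hb1) b
  set η : ℝ → ℝ := fun y => ∫ s in (0 : ℝ)..y, θ s with hη_def
  have hη : ∀ y, HasDerivAt η (θ y) y := fun y =>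
    intervalIntegral.integral_hasDerivAt_right (hθ1.continuous.intervalIntegrable _ _)
      (hθ1.continuous.stronglyMeasurableAtFilter _ _) hθ1.continuous.continuousAt
  have hηm : StrictMono η := strictMono_of_hasDerivAt_pos hη hθ0
  have hη0 : η 0 = 0 := intervalIntegral.integral_same
  have hηle : ∀ y, 0 ≤ y → y ≤ b → η y ≤ δ := by
    intro y hy0 hyb
    have h1 : η y - η 0 ≤ δ / b * (y - 0) := by
      refine Convex.image_sub_le_mul_sub_of_deriv_le (convex_Iic y)
        (fun z _ => (hη z).continuousAt.continuousWithinAt)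
        (fun z _ => (hη z).differentiableAt.differentiableWithinAt) ?_ 0 hy0 y self_mem_Iic hy0
      intro z hz
      rw [interior_Iic] at hz
      rw [(hη z).deriv]
      exact hθδ z ((le_of_lt hz).trans hyb)
    have h2 : δ / b * (y - 0) ≤ δ / b * b := by
      gcongr
      linarith
    rw [div_mul_cancel₀ _ hb1.ne'] at h2
    linarith
  have hη1 : ContDiff ℝ 1 η := by
    rw [contDiff_one_iff_deriv]
    refine ⟨fun y => (hη y).differentiableAt, ?_⟩
    rw [show deriv η = θ from funext fun y => (hη y).deriv]
    exact hθ1.continuous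
  set h : Heis m → ℝ := fun q => η (w₁ q) with hh
  have hh1 : ContDiff ℝ 1 h := hη1.comp (hw₁s.of_le (by simp))
  have hsphere : ∀ q ∈ Metric.sphere q₀ r, u q + h q ≤ c := by
    intro q hq
    rcases le_or_gt 0 (w₁ q) with h0 | h0
    · have h1 := hδA q ⟨hq, h0⟩
      have h2 := hηle _ h0 (hbK q (Metric.sphere_subset_closedBall hq))
      simp only [hh] at h1 ⊢
      linarith
    · have h1 := hηm h0
      have h2 := hle q (hKΩ (Metric.sphere_subset_closedBall hq))
      rw [hη0] at h1
      simp only [hh]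
      linarith
  have hBK : Metric.ball q₀ r ⊆ K := Metric.ball_subset_closedBall
  have hfl : ContDiffOn ℝ 1 (heisFlux φ h) (Metric.ball q₀ r) := by
    rw [contDiffOn_euclidean]
    intro i
    have h1 : (fun q => heisFlux φ h q i) = fun q => _ :=
      funext fun q => heisFlux_comp (φ := φ) hη hθ0 hw₁s q i
    rw [h1]
    refine ((contDiffOn_phi_comp hφ hθ0 hθ1 hw₁s).mul
      (contDiffOn_heisGrad_div_norm hw₁s i)).mono fun q hq hq0 => ?_
    have h2 := (hr' (hBK hq)).2.1.1
    rw [hq0, norm_zero] at h2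
    linarith
  have hball : ∀ q ∈ Metric.ball q₀ r, u q + h q ≤ c := by
    intro q hq
    -- Raising the level to c + ε keeps the closed superlevel set off the sphere, so it is a compact
    -- subset of the open ball.
    refine le_of_forall_pos_le_add fun ε hε => ?_
    have hK' : IsCompact (K ∩ {q | c + ε ≤ u q + h q}) :=
      hK.of_isClosed_subset ((hucK.add hh1.continuous.continuousOn).preimage_isClosed_of_isClosed
        hK.isClosed isClosed_Ici) inter_subset_left
    refine hsub.comparison hφ hΩ hu Metric.isOpen_ball (hBK.trans hKΩ) hK' (fun p hp => ?_)
      hh1.contDiffOn hfl (fun p hp => ?_) (fun p hp hp' => ⟨hBK hp, hp'.le⟩) q hq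
    · rcases (Metric.mem_closedBall.1 hp.1).lt_or_eq with h1 | h1
      · exact h1
      · have h2 := hsphere p h1
        have h3 : c + ε ≤ u p + h p := hp.2
        linarith
    · exact hdiv η θ hη hθ1 hθ0 p (hBK hp) (hode _ (hbK p (hBK hp)))
  have hh0 : h q₀ = 0 := by simp only [hh, hw₁0, hη0]
  have hmax : IsLocalMax (fun q => u q + h q) q₀ := by
    filter_upwards [Metric.ball_mem_nhds q₀ hr] with q hq
    rw [hh0, huq₀, add_zero]
    exact hball q hq
  have humax : IsLocalMax u q₀ := by
    filter_upwards [hΩ.mem_nhds hq₀] with q hq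
    rw [huq₀]
    exact hle q hq
  have hud := (hu.contDiffAt (hΩ.mem_nhds hq₀)).differentiableAt one_ne_zero
  have h1 := hmax.fderiv_eq_zero
  rw [fderiv_fun_add hud (hh1.differentiable one_ne_zero q₀), humax.fderiv_eq_zero, zero_add] at h1
  have h2 : fderiv ℝ h q₀ = θ (w₁ q₀) • fderiv ℝ w₁ q₀ :=
    ((hη (w₁ q₀)).comp_hasFDerivAt q₀ (hw₁s.differentiable (by simp) q₀).hasFDerivAt).fderiv
  rw [h2, smul_eq_zero] at h1
  have h3 : fderiv ℝ w₁ q₀ = 0 := h1.resolve_left (hθ0 _).ne'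
  have h4 : heisGrad w₁ q₀ = (0 : ℝ) • heisGrad w₁ q₀ := heisGrad_eq_smul (by rw [h3, smul_zero])
  rw [zero_smul] at h4
  rw [h4, norm_zero] at hnorm
  norm_num at hnorm

end Touching

/-! ### Propagation along horizontal flows and filling by commutators -/

section Propagation

variable {m : ℕ}

/-- The t-component is an antisymmetric form in the horizontal coordinates, so moving along a does
not change it: the flow lines are straight segments. -/
theorem heisHor_add_smul (q : Heis m) (a : EuclideanSpace ℝ (Fin m ⊕ Fin m)) (s : ℝ) :
    heisHor (q + s • heisHor q a) a = heisHor q a := by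
  simp only [heisHor_eq]
  congr! 4 with j
  simp
  ring

theorem contDiff_heisHor (a : EuclideanSpace ℝ (Fin m ⊕ Fin m)) :
    ContDiff ℝ ∞ fun q : Heis m => heisHor q a :=
  ContDiff.sum fun i _ => (contDiff_heisFrame i).const_smul (a i)

/-- A relatively closed set without nonzero horizontal normals is invariant under the
horizontal left-invariant flows. -/
theorem add_heisHor_mem_of_touching {Ω F : Set (Heis m)} (hΩ : IsOpen Ω)
    (hFc : ∀ K ⊆ Ω, IsCompact K → IsCompact (K ∩ F))
    (htouch : ∀ q₀ ∈ F, ∀ w : Heis m → ℝ, ContDiff ℝ ∞ w →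
      (∀ᶠ q in 𝓝 q₀, q ∈ F → w q ≤ w q₀) → heisGrad w q₀ = 0)
    {p : Heis m} (hp : p ∈ F) (a : EuclideanSpace ℝ (Fin m ⊕ Fin m))
    (hseg : ∀ s ∈ Icc (0 : ℝ) 1, p + s • heisHor p a ∈ Ω) : p + heisHor p a ∈ F := by
  rcases eq_or_ne a 0 with rfl | ha
  · simpa [heisHor] using hp
  by_contra hend
  set γ : ℝ → Heis m := fun s => p + s • heisHor p a with hγ
  have hγc : Continuous γ := by fun_prop
  have hSc : IsCompact (Icc (0 : ℝ) 1 ∩ γ ⁻¹' F) := by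
    have h1 := hFc (γ '' Icc 0 1) (by rintro _ ⟨s, hs, rfl⟩; exact hseg s hs)
      (isCompact_Icc.image hγc)
    have h2 : Icc (0 : ℝ) 1 ∩ γ ⁻¹' F = Icc 0 1 ∩ γ ⁻¹' (γ '' Icc 0 1 ∩ F) := by
      ext s
      exact ⟨fun hs => ⟨hs.1, mem_image_of_mem γ hs.1, hs.2⟩, fun hs => ⟨hs.1, hs.2.2⟩⟩
    rw [h2]
    exact isCompact_Icc.inter_right (h1.isClosed.preimage hγc)
  obtain ⟨s₀, ⟨hs₀, hs₀F⟩, hs₀max⟩ := hSc.exists_isGreatest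
    ⟨0, by simp, by simpa [hγ] using hp⟩
  have hs₀1 : s₀ < 1 := hs₀.2.lt_of_ne fun h => hend (by
    rw [h] at hs₀F
    simpa [hγ] using hs₀F)
  -- flow-box coordinates: `σ` is the time and `π` the projection along the flow
  set σ : Heis m → ℝ := fun q => (∑ j, a (Sum.inl j) * (q.1 j - p.1 j) +
    ∑ j, a (Sum.inr j) * (q.2.1 j - p.2.1 j)) / ‖a‖ ^ 2 with hσ
  set π : Heis m → Heis m := fun q => q - σ q • heisHor q a - p with hπ
  have ha2 : ‖a‖ ^ 2 ≠ 0 := pow_ne_zero _ (norm_ne_zero_iff.2 ha)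
  have hσs : ContDiff ℝ ∞ σ := by fun_prop
  have hπs : ContDiff ℝ ∞ π :=
    (contDiff_id.sub (hσs.smul (contDiff_heisHor a))).sub contDiff_const
  have hσflow : ∀ (q : Heis m) (s : ℝ), σ (q + s • heisHor q a) = σ q + s := by
    intro q s
    have h1 : ‖a‖ ^ 2 = ∑ j, a (Sum.inl j) ^ 2 + ∑ j, a (Sum.inr j) ^ 2 := by
      rw [EuclideanSpace.real_norm_sq_eq, Fintype.sum_sum_type]
    simp only [hσ]
    rw [div_add' _ _ _ ha2]
    congr 1
    rw [h1]
    simp only [Finset.mul_sum, mul_add, ← Finset.sum_add_distrib]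
    refine Finset.sum_congr rfl fun j _ => ?_
    simp [heisHor_eq]
    ring
  have hπflow : ∀ (q : Heis m) (s : ℝ), π (q + s • heisHor q a) = π q := by
    intro q s
    simp only [hπ, hσflow, heisHor_add_smul]
    module
  have hσp : σ p = 0 := by simp [hσ]
  have hσγ : ∀ s, σ (γ s) = s := fun s => by rw [hγ, hσflow, hσp, zero_add]
  have hπγ : ∀ s, π (γ s) = 0 := fun s => by
    rw [hγ, hπflow]
    simp [hπ, hσp]
  have hπ0 : ∀ q, π q = 0 → q = γ (σ q) := by
    intro q hq
    have h1 : p = q + (-σ q) • heisHor q a := by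
      rw [← sub_eq_zero.1 hq]
      module
    simp only [hγ]
    conv_rhs => rw [h1, heisHor_add_smul]
    module
  have hev : ∀ᶠ q in 𝓝 (γ s₀), q ∈ Ω ∧ σ q < 1 :=
    (hΩ.eventually_mem (hseg s₀ hs₀)).and
      (hσs.continuous.continuousAt.eventually (gt_mem_nhds ((hσγ s₀).trans_lt hs₀1)))
  obtain ⟨ρ, hρ, hρ'⟩ := Metric.nhds_basis_closedBall.eventually_iff.1 hev
  set K := Metric.closedBall (γ s₀) ρ with hK
  have hKF : IsCompact (K ∩ F) := hFc K (fun q hq => (hρ' hq).1) (isCompact_closedBall _ _)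
  have hA : IsCompact (K ∩ F ∩ (Metric.sphere (γ s₀) ρ ∩ {q | s₀ ≤ σ q})) :=
    hKF.inter_right (Metric.isClosed_sphere.inter (isClosed_le continuous_const hσs.continuous))
  have hQc : ContDiff ℝ ∞ fun q => heisSq (π q) := contDiff_heisSq.comp hπs
  -- A point of K ∩ F with π = 0 and σ ≥ s₀ lies on γ, and s₀ is the last time γ is in F, so it is
  -- the centre γ(s₀) and not on the sphere.
  obtain ⟨ε, hε, hεA⟩ := hA.exists_forall_le' (f := fun q => heisSq (π q)) (a := 0)
    hQc.continuous.continuousOn fun q hq => by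
      refine heisSq_pos fun h0 => ?_
      have h1 := hπ0 q h0
      have h2 : σ q ≤ s₀ := hs₀max ⟨⟨hs₀.1.trans hq.2.2, (hρ' hq.1.1).2.le⟩, by
        rw [mem_preimage, ← h1]
        exact hq.1.2⟩
      rw [le_antisymm h2 hq.2.2] at h1
      have h3 := hq.2.1
      rw [h1, Metric.mem_sphere, dist_self] at h3
      exact hρ.ne h3
  -- On K one has σ < 1, so this coefficient gives w < s₀ = w(γ(s₀)) on the part of F on the sphere
  -- with σ ≥ s₀; where σ < s₀ that is clear. The maximum over K ∩ F is therefore interior.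
  set w : Heis m → ℝ := fun q => σ q - (1 - s₀) / ε * heisSq (π q) with hw
  have hws : ContDiff ℝ ∞ w := hσs.sub (contDiff_const.mul hQc)
  have hw0 : w (γ s₀) = s₀ := by simp [hw, hσγ, hπγ, heisSq_zero]
  have hcoef : 0 < (1 - s₀) / ε := div_pos (by linarith) hε
  obtain ⟨q, hq, hqmax⟩ := hKF.exists_isMaxOn
    ⟨γ s₀, Metric.mem_closedBall_self hρ.le, hs₀F⟩ hws.continuous.continuousOn
  have hwq : s₀ ≤ w q := hw0 ▸ hqmax ⟨Metric.mem_closedBall_self hρ.le, hs₀F⟩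
  have hqball : q ∈ Metric.ball (γ s₀) ρ := by
    rcases (Metric.mem_closedBall.1 hq.1).lt_or_eq with h1 | h1
    · exact h1
    exfalso
    have h2 : s₀ ≤ σ q := by
      have := mul_nonneg hcoef.le (heisSq_nonneg (π q))
      simp only [hw] at hwq
      linarith
    have h3 := hεA q ⟨hq, h1, h2⟩
    have h4 : (1 - s₀) / ε * ε ≤ (1 - s₀) / ε * heisSq (π q) :=
      mul_le_mul_of_nonneg_left h3 hcoef.le
    rw [div_mul_cancel₀ _ hε.ne'] at h4
    have h5 := (hρ' hq.1).2
    simp only [hw] at hwq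
    linarith
  have hgrad := htouch q hq.2 w hws (by
    filter_upwards [Metric.isOpen_ball.mem_nhds hqball] with q' hq' hq'F
    exact hqmax ⟨Metric.ball_subset_closedBall hq', hq'F⟩)
  have h1 : fderiv ℝ w q (heisHor q a) = 0 := by
    rw [← inner_heisGrad, hgrad, inner_zero_right]
  -- Along the flow σ grows at unit rate and π is constant, so w has derivative 1, whereas a
  -- vanishing horizontal gradient gives 0.
  have h2 : HasDerivAt (fun s : ℝ => w (q + s • heisHor q a)) (fderiv ℝ w q (heisHor q a)) 0 := by
    have h3 : HasDerivAt (fun s : ℝ => q + s • heisHor q a) (heisHor q a) 0 := by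
      simpa using ((hasDerivAt_id (0 : ℝ)).smul_const (heisHor q a)).const_add q
    have h4 : HasFDerivAt w (fderiv ℝ w q) (q + (0 : ℝ) • heisHor q a) := by
      simpa using (hws.differentiable (by simp) q).hasFDerivAt
    exact h4.comp_hasDerivAt 0 h3
  have h3 : (fun s : ℝ => w (q + s • heisHor q a)) = fun s => w q + s := by
    funext s
    simp only [hw, hσflow, hπflow]
    ring
  rw [h3, h1] at h2
  exact zero_ne_one (h2.unique ((hasDerivAt_id (0 : ℝ)).const_add (w q)))

/-- Any point near `q₀` is reached from `q₀` by a chain of horizontal segments near `q₀`. -/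
theorem mem_nhds_of_horizontal_invariant (hm : 1 ≤ m) {F : Set (Heis m)} {q₀ : Heis m} {r : ℝ}
    (hr : 0 < r) (hq₀ : q₀ ∈ F)
    (hinv : ∀ p ∈ F, ∀ a, p ∈ Metric.ball q₀ r → p + heisHor p a ∈ Metric.ball q₀ r →
      p + heisHor p a ∈ F) : F ∈ 𝓝 q₀ := by
  have hcont : ∀ (f : Heis m → Heis m) (a : Heis m → EuclideanSpace ℝ (Fin m ⊕ Fin m)),
      Continuous f → Continuous a → Continuous fun q => f q + heisHor (f q) (a q) := by
    intro f a hf ha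
    refine hf.add (continuous_finsetSum _ fun i _ => ?_)
    exact ((EuclideanSpace.proj i).continuous.comp ha).smul
      ((contDiff_heisFrame i).continuous.comp hf)
  let j : Fin m := ⟨0, hm⟩
  -- One segment corrects the x and y coordinates; τ is the defect remaining in t.
  let a₁ : Heis m → EuclideanSpace ℝ (Fin m ⊕ Fin m) := fun q =>
    WithLp.toLp 2 (Sum.elim (q.1 - q₀.1) (q.2.1 - q₀.2.1))
  let g₁ : Heis m → Heis m := fun q => q₀ + heisHor q₀ (a₁ q)
  let τ : Heis m → ℝ := fun q => q.2.2 - (g₁ q).2.2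
  -- The loop αX, βY, -αX, -βY shifts t by -4αβ, so αβ = -τ/4 is wanted. This choice is continuous
  -- for τ of either sign and vanishes with τ, so the path stays near q₀.
  let α : Heis m → ℝ := fun q => (√(τ q) + √(-τ q)) / 2
  let β : Heis m → ℝ := fun q => (√(-τ q) - √(τ q)) / 2
  let eX : EuclideanSpace ℝ (Fin m ⊕ Fin m) := EuclideanSpace.single (Sum.inl j) 1
  let eY : EuclideanSpace ℝ (Fin m ⊕ Fin m) := EuclideanSpace.single (Sum.inr j) 1
  let g₂ : Heis m → Heis m := fun q => g₁ q + heisHor (g₁ q) (α q • eX)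
  let g₃ : Heis m → Heis m := fun q => g₂ q + heisHor (g₂ q) (β q • eY)
  let g₄ : Heis m → Heis m := fun q => g₃ q + heisHor (g₃ q) (-α q • eX)
  let g₅ : Heis m → Heis m := fun q => g₄ q + heisHor (g₄ q) (-β q • eY)
  have ha₁ : Continuous a₁ := by
    refine (PiLp.continuous_toLp 2 _).comp (continuous_pi fun i => ?_)
    rcases i with i | i <;> simp only [Sum.elim_inl, Sum.elim_inr] <;> fun_prop
  have hg₁ : Continuous g₁ := hcont _ _ continuous_const ha₁
  have hτ : Continuous τ := by fun_prop
  have hα : Continuous α := by fun_prop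
  have hβ : Continuous β := by fun_prop
  have hg₂ : Continuous g₂ := hcont _ _ hg₁ (hα.smul continuous_const)
  have hg₃ : Continuous g₃ := hcont _ _ hg₂ (hβ.smul continuous_const)
  have hg₄ : Continuous g₄ := hcont _ _ hg₃ (hα.neg.smul continuous_const)
  have hor0 : ∀ q : Heis m, heisHor q 0 = 0 := fun q => by simp [heisHor]
  have e1 : g₁ q₀ = q₀ := by
    have : a₁ q₀ = 0 := by
      ext i
      rcases i with i | i <;> simp [a₁]
    simp [g₁, this, hor0]
  have eτ : τ q₀ = 0 := by simp [τ, e1]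
  have eα : α q₀ = 0 := by simp [α, eτ]
  have eβ : β q₀ = 0 := by simp [β, eτ]
  have e2 : g₂ q₀ = q₀ := by simp [g₂, e1, eα, hor0]
  have e3 : g₃ q₀ = q₀ := by simp [g₃, e2, eβ, hor0]
  have e4 : g₄ q₀ = q₀ := by simp [g₄, e3, eα, hor0]
  have h5 : ∀ q, g₅ q = q := by
    intro q
    have hαβ : α q * β q = -τ q / 4 := by
      have h1 : α q * β q = (√(-τ q) ^ 2 - √(τ q) ^ 2) / 4 := by
        simp only [α, β]
        ring
      rw [h1]
      rcases le_total 0 (τ q) with h0 | h0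
      · rw [Real.sq_sqrt h0, Real.sqrt_eq_zero_of_nonpos (neg_nonpos.2 h0)]
        ring
      · rw [Real.sq_sqrt (neg_nonneg.2 h0), Real.sqrt_eq_zero_of_nonpos h0]
        ring
    have hx : ∀ i, (g₁ q).1 i = q.1 i := fun i => by simp [g₁, heisHor_eq, a₁]
    have hy : ∀ i, (g₁ q).2.1 i = q.2.1 i := fun i => by simp [g₁, heisHor_eq, a₁]
    have ht : (g₁ q).2.2 = q.2.2 - τ q := by simp [τ]
    refine Prod.ext (funext fun i => ?_) (Prod.ext (funext fun i => ?_) ?_)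
    · simp [g₅, g₄, g₃, g₂, heisHor_eq, eX, eY, hx]
    · simp [g₅, g₄, g₃, g₂, heisHor_eq, eX, eY, hy]
    · simp [g₅, g₄, g₃, g₂, heisHor_eq, eX, eY, hx, hy, ht]
      linear_combination (-4) * hαβ
  have hball : ∀ g : Heis m → Heis m, Continuous g → g q₀ = q₀ →
      ∀ᶠ q in 𝓝 q₀, g q ∈ Metric.ball q₀ r := fun g hg hgq =>
    hg.continuousAt.eventually (by rw [hgq]; exact Metric.ball_mem_nhds q₀ hr)
  filter_upwards [hball g₁ hg₁ e1, hball g₂ hg₂ e2, hball g₃ hg₃ e3, hball g₄ hg₄ e4,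
    Metric.ball_mem_nhds q₀ hr] with q b1 b2 b3 b4 b5
  have m1 : g₁ q ∈ F := hinv q₀ hq₀ _ (Metric.mem_ball_self hr) b1
  have m2 : g₂ q ∈ F := hinv _ m1 _ b1 b2
  have m3 : g₃ q ∈ F := hinv _ m2 _ b2 b3
  have m4 : g₄ q ∈ F := hinv _ m3 _ b3 b4
  have m5 : g₅ q ∈ F := hinv _ m4 _ b4 (by
    change g₅ q ∈ _
    rw [h5]
    exact b5)
  rwa [h5] at m5

end Propagation

/-! ### The strong maximum principle -/

theorem mainTheorem9 (m : ℕ) (hm : 1 ≤ m) (φ : ℝ → ℝ) (hφ : PhiStructural φ)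
    (hφ2 : PhiRelaxedHomogeneous φ) (Ω : Set (Heis m)) (hΩ_open : IsOpen Ω)
    (hΩ_conn : IsConnected Ω) (u : Heis m → ℝ) (hu_cont : ContinuousOn u (closure Ω))
    (hu_diff : ContDiffOn ℝ 1 u Ω) (hu_sub : PhiLaplacianNonneg φ Ω u)
    (uStar : ℝ) (huStar : IsLUB (u '' Ω) uStar)
    (qM : Heis m) (hqM : qM ∈ Ω) (hmax : u qM = uStar) :
    ∀ q ∈ closure Ω, u q = uStar := by
  have hle : ∀ q ∈ Ω, u q ≤ uStar := fun q hq => huStar.1 (mem_image_of_mem u hq)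
  set F : Set (Heis m) := Ω ∩ {q | u q = uStar} with hF
  have hFc : ∀ K ⊆ Ω, IsCompact K → IsCompact (K ∩ F) := by
    intro K hKΩ hK
    have h1 : K ∩ F = K ∩ u ⁻¹' {uStar} := by
      ext q
      exact ⟨fun hq => ⟨hq.1, hq.2.2⟩, fun hq => ⟨hq.1, hKΩ hq.1, hq.2⟩⟩
    rw [h1]
    exact hK.of_isClosed_subset ((hu_diff.continuousOn.mono hKΩ).preimage_isClosed_of_isClosed
      hK.isClosed isClosed_singleton) inter_subset_left
  have htouch : ∀ q₀ ∈ F, ∀ w : Heis m → ℝ, ContDiff ℝ ∞ w →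
      (∀ᶠ q in 𝓝 q₀, q ∈ F → w q ≤ w q₀) → heisGrad w q₀ = 0 := by
    intro q₀ hq₀ w hw hev
    refine hu_sub.heisGrad_eq_zero_of_touching hφ hφ2 hΩ_open hu_diff hle hq₀.1 hq₀.2 hw ?_
    filter_upwards [hev, hΩ_open.mem_nhds hq₀.1] with q h1 h2 h3
    exact h1 ⟨h2, h3⟩
  have hFo : IsOpen F := by
    rw [isOpen_iff_mem_nhds]
    intro q₀ hq₀
    obtain ⟨r, hr, hrΩ⟩ := Metric.isOpen_iff.1 hΩ_open q₀ hq₀.1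
    -- Horizontal flow lines are segments and balls are convex, so the flow between two points of
    -- the ball stays in Ω.
    refine mem_nhds_of_horizontal_invariant hm hr hq₀ fun p hp a hpb hpb' => ?_
    refine add_heisHor_mem_of_touching hΩ_open hFc htouch hp a fun s hs => hrΩ ?_
    exact (convex_ball q₀ r).add_smul_mem hpb hpb' hs
  have hsub : Ω ⊆ F := by
    refine hΩ_conn.isPreconnected.subset_of_closure_inter_subset hFo ⟨qM, hqM, hqM, hmax⟩ ?_
    rintro q ⟨hq, hqΩ⟩
    refine ⟨hqΩ, ?_⟩
    have h1 := (hu_diff.continuousOn.continuousAt (hΩ_open.mem_nhds hqΩ)).continuousWithinAt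
      (s := F)
    have h2 := h1.mem_closure hq (t := {uStar}) fun p hp => hp.2
    simpa using h2
  have heq : EqOn u (fun _ => uStar) Ω := fun q hq => (hsub hq).2
  exact heq.of_subset_closure hu_cont continuousOn_const subset_closure subset_rfl
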